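/- Let $d\ge 1$, $0<\alpha<1$, and let $-\Delta$ be the negative discrete Laplacian on $\ell^2(\mathbb Z^d)$, $(-\Delta f)(x)=\sum_{j=1}^d\big(2f(x)-f(x+e_j)-f(x-e_j)\big)$. Let $(-\Delta)^\alpha$ be its fractional power defined by functional calculus, and write $T(x,y)=\langle\delta_x,T\delta_y\rangle$ for the matrix elements of a bounded operator $T$. Let $P_0$ be a compactly supported probability measure on $\mathbb R$, let $\omega=(\omega_x)_{x\in\mathbb Z^d}$ have law $\mathbb P=\bigotimes_{\mathbb Z^d}P_0$, and for $\lambda>0$ and $z\in\mathbb C\setminus\mathbb R$ put $$H_{\alpha,\omega}=(-\Delta)^\alpha+\lambda V_\omega,\qquad (V_\omega f)(x)=\omega_xf(x),\qquad G_z=(H_{\alpha,\omega}-z)^{-1}.$$ The measure $P_0$ is called $\tau$-regular if there is $C>0$ with $P_0([v-\delta,v+\delta])\le C\delta^\tau$ for all $v\in\mathbb R$, $\delta>0$; the infimum of such $C$ is denoted $M_\tau(P_0)$. For a kernel $D:\mathbb Z^d\times\mathbb Z^d\to[0,\infty)$ let $\mathcal W^{\mathrm{SAW}}_n(0,x)$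 be the set of self-avoiding walks $w=(w_0,\dots,w_n)$ in $\mathbb Z^d$ (pairwise distinct sites, steps of arbitrary length) with $w_0=0$ and $w_n=x$, and set, with values in $[0,\infty]$, $$C^{\mathrm{SAW}}_{D,\gamma}(x)=\sum_{n\ge0}\gamma^n\sum_{w\in\mathcal W^{\mathrm{SAW}}_n(0,x)}\ \prod_{j=0}^{n-1}D(w_j,w_{j+1}),\qquad \chi^{\mathrm{SAW}}_{D,\gamma}=\sum_{x\in\mathbb Z^d}C^{\mathrm{SAW}}_{D,\gamma}(x).$$ Let $R_\chi=\sup\{\gamma\ge0:\chi^{\mathrm{SAW}}_{D,\gamma}<\infty\}$ be the radius of convergence of the susceptibility $\chi^{\mathrm{SAW}}_{D,\gamma}$ as a power series in $\gamma$. **Theorem.** Assume that $P_0$ is $\tau$-regular for some $\tau\in\left(\frac{d}{d+2\alpha},1\right)$. Let $s\in\left(\frac{d}{d+2\alpha},\tau\right)$, take $D(x,y)=|(-\Delta)^\alpha(x,y)|^s$, and set $$\theta_s=\frac{\tau}{\tau-s}\,M_\tau(P_0)^{s/\tau},\qquad \lambda_0(s)=\left(\frac{\theta_s}{R_\chi}\right)^{1/s}.$$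 Then $R_\chi>0$, so that $\lambda_0(s)<\infty$. Moreover, for every $\lambda>\lambda_0(s)$, with $\gamma=\theta_s/\lambda^s$, one has $C^{\mathrm{SAW}}_{D,\gamma}(x)<\infty$ for all $x\in\mathbb Z^d$, and for all $z\in\mathbb C\setminus\mathbb R$ and all $x\ne x_0$ in $\mathbb Z^d$, $$\mathbb E\big[|G_z(x_0,x)|^s\big]\le\gamma\,C^{\mathrm{SAW}}_{D,\gamma}(x-x_0).$$ -/

import Mathlib

open MeasureTheory
open scoped ENNReal NNReal

noncomputable section

namespace FracAnderson

/-- The lattice `ℤ^d`. -/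
abbrev Lat (d : ℕ) : Type := Fin d → ℤ

/-- The Hilbert space `ℓ²(ℤ^d)` of complex square-summable sequences. -/
def Ell2 (d : ℕ) : Type := lp (fun _ : Lat d => ℂ) 2

namespace Ell2

variable {d : ℕ}

instance : NormedAddCommGroup (Ell2 d) :=
  inferInstanceAs (NormedAddCommGroup (lp (fun _ : Lat d => ℂ) 2))

instance : InnerProductSpace ℂ (Ell2 d) :=
  inferInstanceAs (InnerProductSpace ℂ (lp (fun _ : Lat d => ℂ) 2))

instance : CompleteSpace (Ell2 d) :=
  inferInstanceAs (CompleteSpace (lp (fun _ : Lat d => ℂ) 2))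

/-- The coordinates of `f ∈ ℓ²(ℤ^d)`; written `f x` below. -/
def coord (f : Ell2 d) : Lat d → ℂ := f.1

instance : CoeFun (Ell2 d) (fun _ => Lat d → ℂ) := ⟨coord⟩

/-- A square-summable function as an element of `ℓ²(ℤ^d)`. -/
def mk (f : Lat d → ℂ) (hf : Memℓp f 2) : Ell2 d :=
  (⟨f, hf⟩ : lp (fun _ : Lat d => ℂ) 2)

/-- The canonical basis vector `δ_y`. -/
def delta (y : Lat d) : Ell2 d :=
  (lp.single 2 y (1 : ℂ) : lp (fun _ : Lat d => ℂ) 2)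

lemma mk_apply (f : Lat d → ℂ) (hf : Memℓp f 2) (x : Lat d) : mk f hf x = f x := rfl

lemma delta_apply (y x : Lat d) : delta y x = if x = y then 1 else 0 := by
  have h : delta y x = (Pi.single y (1 : ℂ) : Lat d → ℂ) x := rfl
  rw [h, Pi.single_apply]

lemma add_apply (f g : Ell2 d) (x : Lat d) : (f + g) x = f x + g x := rfl

lemma sub_apply (f g : Ell2 d) (x : Lat d) : (f - g) x = f x - g x := rfl

lemma smul_apply (c : ℂ) (f : Ell2 d) (x : Lat d) : (c • f) x = c * f x := rfl

lemma sum_apply {ι : Type*} (t : Finset ι) (F : ι → Ell2 d) (x : Lat d) :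
    (∑ i ∈ t, F i) x = ∑ i ∈ t, F i x := by
  classical
  induction t using Finset.induction_on with
  | empty => rfl
  | insert i t hi ih => rw [Finset.sum_insert hi, Finset.sum_insert hi, add_apply, ih]

@[ext]
lemma ext {f g : Ell2 d} (h : ∀ x, f x = g x) : f = g := lp.ext (funext h)

lemma memlp (f : Ell2 d) : Memℓp (fun x => f x) 2 :=
  lp.memℓp (show lp (fun _ : Lat d => ℂ) 2 from f)

lemma norm_sq_eq_tsum (f : Ell2 d) : ‖f‖ ^ 2 = ∑' x, ‖f x‖ ^ 2 := by
  have h := lp.norm_rpow_eq_tsum (p := 2) (by norm_num) (show lp (fun _ : Lat d => ℂ) 2 from f)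
  simp only [ENNReal.toReal_ofNat, Real.rpow_ofNat] at h
  exact h

lemma summable_sq (f : Ell2 d) : Summable fun x => ‖f x‖ ^ 2 := by
  have h := (memℓp_gen_iff (p := 2) (by norm_num)).1 f.memlp
  simpa only [ENNReal.toReal_ofNat, Real.rpow_ofNat] using h

end Ell2

/-- The matrix element `T(x, y) = ⟨δ_x, T δ_y⟩` of a bounded operator on `ℓ²(ℤ^d)`. -/
def matEl {d : ℕ} (T : Ell2 d →L[ℂ] Ell2 d) (x y : Lat d) : ℂ := T (Ell2.delta y) x

/-! ### The discrete Laplacian and its fractional powers -/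

lemma memlp_shift {d : ℕ} (v : Lat d) (f : Ell2 d) :
    Memℓp (fun x : Lat d => f (x + v)) 2 := by
  have hf := f.memlp
  rw [memℓp_gen_iff (by norm_num)] at hf ⊢
  exact hf.comp_injective (add_left_injective v)

/-- The translation `(S_v f)(x) = f(x + v)`, an isometry of `ℓ²(ℤ^d)`. -/
def shift {d : ℕ} (v : Lat d) : Ell2 d →L[ℂ] Ell2 d :=
  LinearMap.mkContinuous
    { toFun := fun f => Ell2.mk (fun x => f (x + v)) (memlp_shift v f)
      map_add' := fun _ _ => Ell2.ext fun _ => rfl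
      map_smul' := fun _ _ => Ell2.ext fun _ => rfl } 1 (by
    intro f
    rw [one_mul]
    refine (pow_le_pow_iff_left₀ (norm_nonneg _) (norm_nonneg _) two_ne_zero).1 ?_
    rw [Ell2.norm_sq_eq_tsum, Ell2.norm_sq_eq_tsum]
    exact ((Equiv.addRight v).tsum_eq (fun x => ‖f x‖ ^ 2)).le)

/-- The negative discrete Laplacian `-Δ` on `ℓ²(ℤ^d)`. -/
def negLaplacian (d : ℕ) : Ell2 d →L[ℂ] Ell2 d :=
  ∑ j : Fin d, ((2 : ℂ) • ContinuousLinearMap.id ℂ (Ell2 d)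
    - shift (Pi.single j 1) - shift (-Pi.single j 1))

lemma negLaplacian_apply {d : ℕ} (f : Ell2 d) (x : Lat d) :
    negLaplacian d f x =
      ∑ j : Fin d, (2 * f x - f (x + Pi.single j 1) - f (x - Pi.single j 1)) := by
  simp only [negLaplacian, _root_.sum_apply, Ell2.sum_apply]
  refine Finset.sum_congr rfl fun j _ => ?_
  rw [sub_eq_add_neg x]
  rfl

/-- The fractional Laplacian `(-Δ)^α`, defined through the continuous functional calculus. -/
def fracLaplacian (d : ℕ) (α : ℝ) : Ell2 d →L[ℂ] Ell2 d :=
  cfc (fun t : ℝ => t ^ α) (negLaplacian d)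

/-! ### The fractional Anderson model -/

lemma memlp_mul {d : ℕ} {v : Lat d → ℝ} {C : ℝ} (hv : ∀ x, |v x| ≤ C) (f : Ell2 d) :
    Memℓp (fun x : Lat d => (v x : ℂ) * f x) 2 := by
  refine (f.memlp.const_smul (C : ℂ)).mono' fun x => ?_
  simp only [Pi.smul_apply, norm_mul, norm_smul, Complex.norm_real, Real.norm_eq_abs]
  exact mul_le_mul_of_nonneg_right ((hv x).trans (le_abs_self _)) (norm_nonneg _)

open Classical in
/-- The multiplication operator `(V f)(x) = v(x) f(x)` for a bounded `v : ℤ^d → ℝ`.  (For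
unbounded `v`, a null event in the model below, the value is `0` by convention.) -/
def mulOp {d : ℕ} (v : Lat d → ℝ) : Ell2 d →L[ℂ] Ell2 d :=
  if hv : ∃ C, ∀ x, |v x| ≤ C then
    LinearMap.mkContinuous
      { toFun := fun f => Ell2.mk (fun x => (v x : ℂ) * f x) (memlp_mul hv.choose_spec f)
        map_add' := fun _ _ => Ell2.ext fun _ => mul_add _ _ _
        map_smul' := fun _ _ => Ell2.ext fun _ => mul_left_comm _ _ _ } |hv.choose| (by
      intro f
      refine (pow_le_pow_iff_left₀ (norm_nonneg _) (by positivity) two_ne_zero).1 ?_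
      rw [mul_pow, Ell2.norm_sq_eq_tsum, Ell2.norm_sq_eq_tsum, ← tsum_mul_left]
      refine (Ell2.summable_sq _).tsum_le_tsum (fun x => ?_) (f.summable_sq.mul_left _)
      rw [← mul_pow]
      refine pow_le_pow_left₀ (norm_nonneg _) ?_ 2
      simp only [LinearMap.coe_mk, AddHom.coe_mk, Ell2.mk_apply, norm_mul, Complex.norm_real,
        Real.norm_eq_abs]
      exact mul_le_mul_of_nonneg_right ((hv.choose_spec x).trans (le_abs_self _))
        (norm_nonneg _))
  else 0

lemma mulOp_apply {d : ℕ} {v : Lat d → ℝ} (hv : ∃ C, ∀ x, |v x| ≤ C) (f : Ell2 d) (x : Lat d) :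
    mulOp v f x = v x * f x := by
  rw [mulOp, dif_pos hv]
  rfl

/-- The Hamiltonian `H_{α,ω} = (-Δ)^α + λ V_ω`. -/
def hamiltonian (d : ℕ) (α lam : ℝ) (ω : Lat d → ℝ) : Ell2 d →L[ℂ] Ell2 d :=
  fracLaplacian d α + (lam : ℂ) • mulOp ω

/-- The Green's function `G_z(x, y) = (H_{α,ω} - z)⁻¹(x, y)`. -/
def green (d : ℕ) (α lam : ℝ) (ω : Lat d → ℝ) (z : ℂ) (x y : Lat d) : ℂ :=
  matEl (Ring.inverse (hamiltonian d α lam ω - z • ContinuousLinearMap.id ℂ (Ell2 d))) x y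

/-- The law `⨂_{ℤ^d} P₀` of the i.i.d. potential `ω = (ω_x)_{x ∈ ℤ^d}`. -/
def disorder (d : ℕ) (P₀ : Measure ℝ) [IsProbabilityMeasure P₀] : Measure (Lat d → ℝ) :=
  Measure.infinitePi fun _ : Lat d => P₀

/-! ### `τ`-regularity -/

/-- `C` is a `τ`-regularity constant of `μ`. -/
def IsRegConst (μ : Measure ℝ) (τ C : ℝ) : Prop :=
  0 < C ∧ ∀ v δ : ℝ, 0 < δ → μ (Set.Icc (v - δ) (v + δ)) ≤ ENNReal.ofReal (C * δ ^ τ)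

/-- `μ` is `τ`-regular. -/
def TauRegular (μ : Measure ℝ) (τ : ℝ) : Prop := ∃ C, IsRegConst μ τ C

/-- The `τ`-constant `M_τ(μ)`, the infimum of the `τ`-regularity constants. -/
def tauConst (μ : Measure ℝ) (τ : ℝ) : ℝ := sInf {C | IsRegConst μ τ C}

/-! ### Self-avoiding walks with long-range jumps -/

/-- Self-avoiding walks `w = (w_0, …, w_n)` on `ℤ^d` with `n` steps from `x₀` to `x`; the steps
may be of any length. -/
def SAW {d : ℕ} (n : ℕ) (x₀ x : Lat d) : Type :=
  {w : Fin (n + 1) → Lat d // w 0 = x₀ ∧ w (Fin.last n) = x ∧ Function.Injective w}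

/-- `c_n^D(x) = ∑_{w ∈ SAW_n(0, x)} ∏_{j < n} D(w_j, w_{j+1})`. -/
def sawCoeff {d : ℕ} (D : Lat d → Lat d → ℝ≥0) (n : ℕ) (x : Lat d) : ℝ≥0∞ :=
  ∑' w : SAW n 0 x, ∏ j : Fin n, (D (w.1 j.castSucc) (w.1 j.succ) : ℝ≥0∞)

/-- The two-point function `C^SAW_{D,γ}(x) = ∑_n c_n^D(x) γ^n`, with values in `[0, ∞]`. -/
def sawTwoPoint {d : ℕ} (D : Lat d → Lat d → ℝ≥0) (γ : ℝ≥0) (x : Lat d) : ℝ≥0∞ :=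
  ∑' n : ℕ, sawCoeff D n x * (γ : ℝ≥0∞) ^ n

/-- The susceptibility `χ^SAW_{D,γ} = ∑_x C^SAW_{D,γ}(x)`, with values in `[0, ∞]`. -/
def susceptibility {d : ℕ} (D : Lat d → Lat d → ℝ≥0) (γ : ℝ≥0) : ℝ≥0∞ :=
  ∑' x : Lat d, sawTwoPoint D γ x

/-- The radius of convergence of the susceptibility, a power series in `γ` with nonnegative
coefficients. -/
def susceptRadius {d : ℕ} (D : Lat d → Lat d → ℝ≥0) : ℝ≥0∞ :=
  ⨆ (γ : ℝ≥0) (_ : susceptibility D γ < ∞), (γ : ℝ≥0∞)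

/-! ### The constants of the theorem -/

/-- The kernel `D_{α,s}(x, y) = |(-Δ)^α(x, y)|^s`.  Self-avoiding walks only use it for
`x ≠ y`. -/
def kernelD (d : ℕ) (α s : ℝ) (x y : Lat d) : ℝ≥0 := ‖matEl (fracLaplacian d α) x y‖₊ ^ s

/-- `θ_s = τ / (τ - s) * M_τ(P₀)^{s/τ}`. -/
def theta (P₀ : Measure ℝ) (τ s : ℝ) : ℝ := τ / (τ - s) * tauConst P₀ τ ^ (s / τ)

/-- `λ₀(s) = (θ_s / R_χ)^{1/s}`, with values in `[0, ∞]`. -/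
def lambda0 (d : ℕ) (α : ℝ) (P₀ : Measure ℝ) (τ s : ℝ) : ℝ≥0∞ :=
  (ENNReal.ofReal (theta P₀ τ s) / susceptRadius (kernelD d α s)) ^ (1 / s)

/-- `γ = θ_s / λ^s`. -/
def gammaParam (P₀ : Measure ℝ) (τ s lam : ℝ) : ℝ≥0 := (theta P₀ τ s / lam ^ s).toNNReal

end FracAnderson

end

open FracAnderson

open scoped InnerProductSpace

/-! Write `A` for `(-Δ)^α` and `G_F` for the resolvent of the Hamiltonian with the sites of `F`
removed. Removing one more site `u` gives `G_F(u,x) = -G_F(u,u) ∑_y A(u,y) G_{F∪{u}}(y,x)` for `x ≠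
u` (`matEl_depletedRes_eq`). The last factor does not depend on `ω_u`. As a function of `ω_u`, the
diagonal entry satisfies `G_F(u,u) (1 + λ ω_u r) = r` with `r` free of `ω_u`, and `τ`-regularity
bounds its `s`-th moment by `γ`, uniformly in the other sites (`lintegral_enorm_rpow_le_of_mul_eq`).
Since `t ↦ t^s` is subadditive, `E|G_F(u,x)|^s ≤ γ ∑_y D(u,y) E|G_{F∪{u}}(y,x)|^s`
(`greenMoment_le_tsum`).

Iteration never returns to a removed site, so it generates self-avoiding walks
(`avoidingSum_expansion`). Walks that have reached `x` carry one extra `γ` from the final diagonal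
entry. After `n` steps the unfinished walks contribute at most `|Im z|^{-s}` times the `n`-th term
of the susceptibility series, which tends to `0` for `γ < R_χ` (`le_mul_sawTwoPoint`).

Positivity of `R_χ` follows from `∑_x D(x,0) < ∞` by dropping self-avoidance. No kernel asymptotics
are needed: `(-Δ)^α = (2d)^α ∑_k c_k P^k` with `P` the simple random walk operator and `c_k =
O(k^{-1-α})`, and the mean of `1 + |x|²` after `k` steps is `k + 1`. Hence the kernel has finite
moments `∑_x |A(x,0)| (1+|x|²)^b` for `0 ≤ b < α`, and Young's inequality converts them into
summability of the `s`-th powers when `s > d/(d+2α)` (`tsum_kernelD_zero_lt_top`). -/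

namespace FracAnderson

/-! ### The binomial series of `(1 - u) ^ α` -/

/-- The Taylor coefficients of `u ↦ (1 - u) ^ α` at `0`. -/
noncomputable def fracCoeff (α : ℝ) (k : ℕ) : ℝ := (-1) ^ k * Ring.choose α k

lemma fracCoeff_zero (α : ℝ) : fracCoeff α 0 = 1 := by
  simp [fracCoeff]

lemma fracCoeff_succ (α : ℝ) (k : ℕ) :
    fracCoeff α (k + 1) = fracCoeff α k * ((k - α) / (k + 1)) := by
  have h : ∀ n, (descPochhammer ℤ n).smeval α = (descPochhammer ℝ n).eval α := fun n => by
    rw [← descPochhammer_map (algebraMap ℤ ℝ) n, Polynomial.eval_map_algebraMap,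
      Polynomial.aeval_eq_smeval]
  simp only [fracCoeff, Ring.choose_eq_smul, smul_eq_mul, h, descPochhammer_succ_eval,
    Nat.factorial_succ, Nat.cast_mul, Nat.cast_add, Nat.cast_one]
  field_simp
  ring

/-- Bernoulli's inequality with exponent `1 + α` bounds the coefficient ratio `(k+1-α)/(k+2)` by
`((k+1)/(k+2))^(1+α)`. The left side is therefore nonincreasing in `k`, and it equals `α` at `k =
0`. -/
lemma abs_fracCoeff_mul_rpow_le {α : ℝ} (h0 : 0 < α) (h1 : α < 1) (k : ℕ) :
    |fracCoeff α (k + 1)| * ((k : ℝ) + 1) ^ (1 + α) ≤ α := by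
  induction k with
  | zero => simp [fracCoeff_succ, fracCoeff_zero, abs_of_pos h0]
  | succ k ih =>
    refine le_trans ?_ ih
    rw [fracCoeff_succ, abs_mul, mul_assoc]
    refine mul_le_mul_of_nonneg_left ?_ (abs_nonneg _)
    have hk : (0 : ℝ) ≤ k := k.cast_nonneg
    push_cast
    rw [abs_of_nonneg (div_nonneg (by linarith) (by linarith))]
    have hb := one_add_mul_self_le_rpow_one_add (s := -1 / ((k : ℝ) + 1 + 1))
      (by rw [le_div_iff₀ (by positivity)]; linarith) (p := 1 + α) (by linarith)
    have e1 : 1 + (1 + α) * (-1 / ((k : ℝ) + 1 + 1)) = (k + 1 - α) / (k + 1 + 1) := by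
      field_simp; ring
    have e2 : 1 + -1 / ((k : ℝ) + 1 + 1) = (k + 1) / (k + 1 + 1) := by
      field_simp; ring
    rw [e1, e2, Real.div_rpow (by positivity) (by positivity), le_div_iff₀ (by positivity)] at hb
    exact hb

lemma summable_abs_fracCoeff_mul_rpow {α b : ℝ} (h0 : 0 < α) (h1 : α < 1) (hb : b < α) :
    Summable fun k : ℕ => |fracCoeff α k| * ((k : ℝ) + 1) ^ b := by
  rw [← summable_nat_add_iff 1]
  have hs : Summable fun k : ℕ => 2 ^ |b| * α * ((k + 1 : ℕ) : ℝ) ^ (-(1 + α - b)) := by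
    refine Summable.mul_left _ ?_
    exact (summable_nat_add_iff 1).2 (Real.summable_nat_rpow.2 (by linarith))
  refine hs.of_nonneg_of_le (fun k => by positivity) fun k => ?_
  have hk : (0 : ℝ) < k + 1 := by positivity
  -- The ratio `(k+2)/(k+1)` lies in `[1, 2]`, so the index shift costs at most `2^|b|` for either
  -- sign of `b`.
  have h2 : ((k : ℝ) + 1 + 1) ^ b ≤ 2 ^ |b| * (k + 1) ^ b := by
    have : ((k : ℝ) + 1 + 1) = ((k : ℝ) + 1 + 1) / (k + 1) * (k + 1) := by field_simp
    rw [this, Real.mul_rpow (by positivity) hk.le]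
    refine mul_le_mul_of_nonneg_right ?_ (by positivity)
    have h3 : 1 ≤ ((k : ℝ) + 1 + 1) / (k + 1) := by rw [le_div_iff₀ hk]; linarith
    calc (((k : ℝ) + 1 + 1) / (k + 1)) ^ b ≤ (((k : ℝ) + 1 + 1) / (k + 1)) ^ |b| :=
          Real.rpow_le_rpow_of_exponent_le h3 (le_abs_self b)
      _ ≤ 2 ^ |b| := by
          refine Real.rpow_le_rpow (by positivity) ?_ (abs_nonneg b)
          rw [div_le_iff₀ hk]; linarith
  have h3 := abs_fracCoeff_mul_rpow_le h0 h1 k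
  have h4 : ((k + 1 : ℕ) : ℝ) ^ (-(1 + α - b)) = (k + 1 : ℝ) ^ b / (k + 1) ^ (1 + α) := by
    push_cast
    rw [← Real.rpow_sub hk]; ring_nf
  rw [h4]
  push_cast
  calc |fracCoeff α (k + 1)| * ((k : ℝ) + 1 + 1) ^ b
      ≤ |fracCoeff α (k + 1)| * (2 ^ |b| * (k + 1) ^ b) := by gcongr
    _ ≤ α / ((k : ℝ) + 1) ^ (1 + α) * (2 ^ |b| * (k + 1) ^ b) := by
        gcongr
        rwa [le_div_iff₀ (by positivity)]
    _ = _ := by ring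

lemma summable_abs_fracCoeff {α : ℝ} (h0 : 0 < α) (h1 : α < 1) :
    Summable fun k : ℕ => |fracCoeff α k| := by
  simpa using summable_abs_fracCoeff_mul_rpow h0 h1 h0

lemma norm_fracCoeff_mul_pow_le {α u : ℝ} (hu : u ∈ Set.Icc (-1 : ℝ) 1) (k : ℕ) :
    ‖fracCoeff α k * u ^ k‖ ≤ |fracCoeff α k| := by
  rw [norm_mul, norm_pow, Real.norm_eq_abs, Real.norm_eq_abs]
  exact mul_le_of_le_one_right (abs_nonneg _) (pow_le_one₀ (abs_nonneg _) (abs_le.2 hu))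

/-- Absolute summability of the coefficients gives uniform convergence by the Weierstrass test. The
limit is identified on the open interval by the binomial series and at the endpoints by continuity.
The endpoints cannot be left out: the spectrum of the averaging operator is only known to lie in the
closed interval. -/
lemma tendstoUniformlyOn_fracCoeff {α : ℝ} (h0 : 0 < α) (h1 : α < 1) :
    TendstoUniformlyOn (fun n u => ∑ k ∈ Finset.range n, fracCoeff α k * u ^ k)
      (fun u => (1 - u) ^ α) Filter.atTop (Set.Icc (-1 : ℝ) 1) := by
  have hu := tendstoUniformlyOn_tsum_nat (f := fun k u => fracCoeff α k * u ^ k)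
    (summable_abs_fracCoeff h0 h1) (s := Set.Icc (-1 : ℝ) 1)
    fun k u hu => norm_fracCoeff_mul_pow_le hu k
  refine hu.congr_right ?_
  have hc : ContinuousOn (fun u => ∑' k, fracCoeff α k * u ^ k) (Set.Icc (-1 : ℝ) 1) :=
    hu.continuousOn (Filter.Frequently.of_forall fun n => by fun_prop)
  have hd : ContinuousOn (fun u : ℝ => (1 - u) ^ α) (Set.Icc (-1 : ℝ) 1) :=
    (Continuous.rpow_const (by fun_prop) fun _ => Or.inr h0.le).continuousOn
  have he : Set.EqOn (fun u => ∑' k, fracCoeff α k * u ^ k) (fun u : ℝ => (1 - u) ^ α)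
      (Set.Ioo (-1 : ℝ) 1) := by
    intro u hu
    have hs := (Real.one_add_rpow_hasFPowerSeriesOnBall_zero (a := α)).hasSum (y := -u) (by
      rw [Metric.mem_eball, edist_zero_right, enorm_neg, ← ofReal_norm, Real.norm_eq_abs,
        ENNReal.ofReal_lt_one]
      exact abs_lt.2 hu)
    refine (hs.congr_fun ?_).tsum_eq.trans (by simp [sub_eq_add_neg])
    intro k
    simp only [binomialSeries_apply, List.ofFn_const, List.prod_replicate, smul_eq_mul, fracCoeff]
    rw [neg_pow]; ring
  refine he.of_subset_closure hc hd Set.Ioo_subset_Icc_self ?_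
  rw [closure_Ioo (by norm_num)]

end FracAnderson

namespace FracAnderson

/-! ### The fractional Laplacian as a series of random walk kernels -/

variable {d : ℕ}

namespace Ell2

lemma norm_apply_le (f : Ell2 d) (x : Lat d) : ‖f x‖ ≤ ‖f‖ := by
  refine (pow_le_pow_iff_left₀ (norm_nonneg _) (norm_nonneg _) two_ne_zero).1 ?_
  rw [norm_sq_eq_tsum]
  exact f.summable_sq.le_tsum x fun y _ => by positivity

/-- Evaluation at a site as a bounded functional. -/
noncomputable def eval (x : Lat d) : Ell2 d →L[ℂ] ℂ :=
  LinearMap.mkContinuous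
    { toFun := fun f => f x, map_add' := fun _ _ => rfl, map_smul' := fun _ _ => rfl } 1
    fun f => (norm_apply_le f x).trans_eq (one_mul _).symm

lemma inner_eq_tsum (f g : Ell2 d) : ⟪f, g⟫_ℂ = ∑' x, ⟪f x, g x⟫_ℂ :=
  lp.inner_eq_tsum (show lp (fun _ : Lat d => ℂ) 2 from f) g

lemma hasSum_delta (f : Ell2 d) : HasSum (fun y => f y • delta y) f := by
  have h := lp.hasSum_single (p := 2) (by norm_num) (show lp (fun _ : Lat d => ℂ) 2 from f)
  refine HasSum.congr_fun (f := fun y => (lp.single 2 y (f y) : lp (fun _ : Lat d => ℂ) 2)) h ?_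
  intro y
  ext x
  change (f y • delta y) x = (Pi.single y (f y) : Lat d → ℂ) x
  rw [smul_apply, delta_apply, Pi.single_apply]
  split_ifs <;> simp

lemma norm_delta (y : Lat d) : ‖delta y‖ = 1 := by
  have h : ‖delta y‖ ^ 2 = 1 := by
    rw [norm_sq_eq_tsum, tsum_eq_single y]
    · simp [delta_apply]
    · intro x hx; simp [delta_apply, hx]
  nlinarith [norm_nonneg (delta y)]

lemma hasSum_matEl (T : Ell2 d →L[ℂ] Ell2 d) (f : Ell2 d) (x : Lat d) :
    HasSum (fun y => matEl T x y * f y) (T f x) := by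
  have h := ((eval x).comp T).hasSum (hasSum_delta f)
  refine h.congr_fun fun y => ?_
  simp only [map_smul, smul_eq_mul]
  rw [mul_comm]; rfl

end Ell2

lemma shift_apply (v : Lat d) (f : Ell2 d) (x : Lat d) : shift v f x = f (x + v) := rfl

lemma norm_shift_le (v : Lat d) : ‖shift v‖ ≤ 1 :=
  LinearMap.mkContinuous_norm_le _ zero_le_one _

lemma adjoint_shift (v : Lat d) : ContinuousLinearMap.adjoint (shift v) = shift (-v) := by
  symm
  rw [ContinuousLinearMap.eq_adjoint_iff]
  intro f g
  rw [Ell2.inner_eq_tsum, Ell2.inner_eq_tsum]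
  rw [← (Equiv.addRight v).tsum_eq]
  simp [shift_apply]

/-- The averaging operator `1 + Δ / (2d)`. -/
noncomputable def avgOp (d : ℕ) : Ell2 d →L[ℂ] Ell2 d :=
  ((2 * d : ℝ)⁻¹) • ∑ j : Fin d, (shift (Pi.single j 1) + shift (-Pi.single j 1))

lemma isSelfAdjoint_avgOp (d : ℕ) : IsSelfAdjoint (avgOp d) := by
  refine IsSelfAdjoint.smul (IsSelfAdjoint.all _) ?_
  refine isSelfAdjoint_sum _ fun j _ => ?_
  rw [IsSelfAdjoint, star_add, ContinuousLinearMap.star_eq_adjoint,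
    ContinuousLinearMap.star_eq_adjoint, adjoint_shift, adjoint_shift, neg_neg, add_comm]

lemma norm_avgOp_le (d : ℕ) : ‖avgOp d‖ ≤ 1 := by
  have h : ‖∑ j : Fin d, (shift (Pi.single j 1 : Lat d) + shift (-Pi.single j 1))‖ ≤ 2 * d := by
    refine (norm_sum_le_of_le Finset.univ (n := fun _ => (2 : ℝ)) fun j _ => ?_).trans_eq (by
        rw [Finset.sum_const, Finset.card_univ, Fintype.card_fin, nsmul_eq_mul, mul_comm])
    refine (norm_add_le _ _).trans ?_
    linarith [norm_shift_le (Pi.single j 1 : Lat d), norm_shift_le (-Pi.single j 1 : Lat d)]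
  rw [avgOp, norm_smul, norm_inv, Real.norm_of_nonneg (by positivity)]
  rcases (Nat.cast_nonneg d : (0 : ℝ) ≤ d).eq_or_lt with h0 | h0
  · rw [← h0, mul_zero, inv_zero, zero_mul]; exact zero_le_one
  · rw [inv_mul_le_iff₀ (by positivity)]; linarith

lemma negLaplacian_eq (hd : 1 ≤ d) : negLaplacian d = (2 * d : ℝ) • (1 - avgOp d) := by
  have h0 : (2 * d : ℝ) ≠ 0 := by positivity
  rw [smul_sub, avgOp, smul_inv_smul₀ h0, negLaplacian]
  simp only [sub_sub, Finset.sum_sub_distrib, Finset.sum_const, Finset.card_univ, Fintype.card_fin]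
  congr 1
  ext f x
  simp only [smul_apply, Ell2.smul_apply, ContinuousLinearMap.id_apply, ← Nat.cast_smul_eq_nsmul ℂ,
    one_apply_eq_self, ← Complex.coe_smul]
  push_cast
  ring

lemma spectrum_avgOp_subset (d : ℕ) : spectrum ℝ (avgOp d) ⊆ Set.Icc (-1) 1 := by
  intro u hu
  have h1 : Nontrivial (Ell2 d) := ⟨⟨Ell2.delta 0, 0, fun h => by
    simpa [h] using Ell2.norm_delta (0 : Lat d)⟩⟩
  have := (spectrum.norm_le_norm_of_mem hu).trans (norm_avgOp_le d)
  exact abs_le.1 this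

lemma isSelfAdjoint_fracLaplacian (d : ℕ) (α : ℝ) : IsSelfAdjoint (fracLaplacian d α) :=
  cfc_predicate _ _

lemma fracLaplacian_eq (hd : 1 ≤ d) {α : ℝ} (h0 : 0 < α) :
    fracLaplacian d α = (2 * d : ℝ) ^ α • cfc (fun u : ℝ => (1 - u) ^ α) (avgOp d) := by
  have hsa := isSelfAdjoint_avgOp d
  have h1 : negLaplacian d = cfc (fun u : ℝ => (2 * d : ℝ) * (1 - u)) (avgOp d) := by
    rw [cfc_const_mul .., cfc_sub .., cfc_const_one .., cfc_id' .., negLaplacian_eq hd]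
  rw [fracLaplacian, h1, ← cfc_comp' (fun t : ℝ => t ^ α) (fun u : ℝ => (2 * d : ℝ) * (1 - u))
    (avgOp d) (Continuous.rpow_const continuous_id fun _ => Or.inr h0.le).continuousOn,
    ← cfc_smul _ _ _ (Continuous.rpow_const (by fun_prop) fun _ => Or.inr h0.le).continuousOn]
  refine cfc_congr fun u hu => ?_
  -- Splitting the power of the product `2d (1 - u)` needs `1 - u ≥ 0`.
  have := spectrum_avgOp_subset d hu
  rw [smul_eq_mul, ← Real.mul_rpow (by positivity) (by linarith [this.2])]

lemma tendsto_sum_fracCoeff_smul_avgOp_pow (d : ℕ) {α : ℝ} (h0 : 0 < α) (h1 : α < 1) :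
    Filter.Tendsto (fun n => ∑ k ∈ Finset.range n, fracCoeff α k • avgOp d ^ k) Filter.atTop
      (nhds (cfc (fun u : ℝ => (1 - u) ^ α) (avgOp d))) := by
  have h := tendsto_cfc_fun (a := avgOp d)
    ((tendstoUniformlyOn_fracCoeff h0 h1).mono (spectrum_avgOp_subset d))
    (Filter.Eventually.of_forall fun n => by fun_prop)
  refine h.congr fun n => ?_
  have hsa := isSelfAdjoint_avgOp d
  rw [← Finset.sum_fn, cfc_sum _ _ _ fun k _ => by fun_prop]
  refine Finset.sum_congr rfl fun k _ => ?_
  rw [cfc_const_mul .., cfc_pow_id ..]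

/-- The `k`-step transition probabilities of the simple random walk. -/
noncomputable def walkProb (d : ℕ) : ℕ → Lat d → ℝ
  | 0, x => if x = 0 then 1 else 0
  | k + 1, x => (2 * d : ℝ)⁻¹ * ∑ j : Fin d,
      (walkProb d k (x + Pi.single j 1) + walkProb d k (x - Pi.single j 1))

lemma walkProb_nonneg (k : ℕ) (x : Lat d) : 0 ≤ walkProb d k x := by
  induction k generalizing x with
  | zero => rw [walkProb]; positivity
  | succ k ih =>
    rw [walkProb]
    exact mul_nonneg (by positivity) (Finset.sum_nonneg fun j _ => add_nonneg (ih _) (ih _))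

lemma avgOp_apply (f : Ell2 d) (x : Lat d) :
    avgOp d f x = (2 * d : ℝ)⁻¹ * ∑ j : Fin d, (f (x + Pi.single j 1) + f (x - Pi.single j 1)) := by
  rw [avgOp]
  simp only [smul_apply, ← Complex.coe_smul, Ell2.smul_apply, _root_.sum_apply, Ell2.sum_apply,
    add_apply, Ell2.add_apply, shift_apply, sub_eq_add_neg]

lemma matEl_avgOp_pow (k : ℕ) (x y : Lat d) : matEl (avgOp d ^ k) x y = walkProb d k (x - y) := by
  induction k generalizing x with
  | zero =>
    simp only [matEl, pow_zero, one_apply_eq_self, Ell2.delta_apply, walkProb,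
      sub_eq_zero]
    split_ifs <;> rfl
  | succ k ih =>
    have h : matEl (avgOp d ^ (k + 1)) x y = avgOp d ((avgOp d ^ k) (Ell2.delta y)) x := by
      rw [matEl, pow_succ']; rfl
    rw [h, avgOp_apply, walkProb, Complex.ofReal_mul, Complex.ofReal_sum]
    congr 1
    refine Finset.sum_congr rfl fun j _ => ?_
    rw [Complex.ofReal_add, sub_add_eq_add_sub, sub_right_comm]
    exact congrArg₂ _ (ih _) (ih _)

/-- The matrix elements of the fractional Laplacian are those of a convolution. -/
lemma tendsto_matEl_fracLaplacian (hd : 1 ≤ d) {α : ℝ} (h0 : 0 < α) (h1 : α < 1) (x y : Lat d) :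
    Filter.Tendsto (fun n => (((2 * d : ℝ) ^ α * ∑ k ∈ Finset.range n,
      fracCoeff α k * walkProb d k (x - y) : ℝ) : ℂ)) Filter.atTop
      (nhds (matEl (fracLaplacian d α) x y)) := by
  have hc : Continuous fun T : Ell2 d →L[ℂ] Ell2 d => matEl T x y :=
    (Ell2.eval x).continuous.comp
      (ContinuousLinearMap.apply ℂ (Ell2 d) (Ell2.delta y)).continuous
  rw [fracLaplacian_eq hd h0]
  refine ((hc.tendsto _).comp ((tendsto_sum_fracCoeff_smul_avgOp_pow d h0 h1).const_smul
    ((2 * d : ℝ) ^ α))).congr fun n => ?_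
  simp only [Function.comp_apply, matEl, smul_apply, _root_.sum_apply, ← Complex.coe_smul,
    Ell2.smul_apply, Ell2.sum_apply]
  have h := fun k => matEl_avgOp_pow (d := d) k x y
  simp only [matEl] at h
  simp only [h, ← Complex.ofReal_mul, ← Complex.ofReal_sum]

end FracAnderson

namespace FracAnderson

/-! ### Summability of fractional powers of the kernel -/

variable {d : ℕ}

/-- The weight `1 + |x|²` on the lattice. -/
def latWeight (x : Lat d) : ℝ := 1 + ∑ i, (x i : ℝ) ^ 2

lemma one_le_latWeight (x : Lat d) : 1 ≤ latWeight x := by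
  rw [latWeight, le_add_iff_nonneg_right]
  exact Finset.sum_nonneg fun i _ => sq_nonneg _

lemma latWeight_pos (x : Lat d) : 0 < latWeight x := zero_lt_one.trans_le (one_le_latWeight x)

/-- By this parallelogram identity, averaging over the `2d` neighbours raises the weight by exactly
`1`, which makes the mean weight of the walk grow linearly. -/
lemma latWeight_add_single (x : Lat d) (j : Fin d) :
    latWeight (x + Pi.single j 1) + latWeight (x - Pi.single j 1) = 2 * latWeight x + 2 := by
  have h : ∀ i, ((x + Pi.single j 1 : Lat d) i : ℝ) ^ 2 + ((x - Pi.single j 1 : Lat d) i : ℝ) ^ 2 =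
      2 * (x i : ℝ) ^ 2 + if i = j then 2 else 0 := by
    intro i
    rw [Pi.add_apply, Pi.sub_apply, Pi.single_apply]
    split_ifs <;> push_cast <;> ring
  rw [latWeight, latWeight, latWeight, add_add_add_comm, ← Finset.sum_add_distrib,
    Finset.sum_congr rfl fun i _ => h i, Finset.sum_add_distrib, ← Finset.mul_sum,
    Finset.sum_ite_eq' Finset.univ j fun _ => (2 : ℝ)]
  simp only [Finset.mem_univ, if_true]
  ring

/-- The averaging operator is symmetric, so one step of the walk can be moved onto the test
function. Working in `[0, ∞]` removes all summability conditions. -/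
lemma tsum_walkProb_succ_mul (k : ℕ) (g : Lat d → ℝ≥0∞) :
    ∑' x, ENNReal.ofReal (walkProb d (k + 1) x) * g x =
      ∑' x, ENNReal.ofReal (walkProb d k x) * (ENNReal.ofReal (2 * d : ℝ)⁻¹ *
        ∑ j : Fin d, (g (x + Pi.single j 1) + g (x - Pi.single j 1))) := by
  have h1 : ∀ x, ENNReal.ofReal (walkProb d (k + 1) x) * g x = ENNReal.ofReal (2 * d : ℝ)⁻¹ *
      ∑ j : Fin d, (ENNReal.ofReal (walkProb d k (x + Pi.single j 1)) * g x
        + ENNReal.ofReal (walkProb d k (x - Pi.single j 1)) * g x) := by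
    intro x
    rw [walkProb, ENNReal.ofReal_mul (by positivity), ENNReal.ofReal_sum_of_nonneg
      fun j _ => add_nonneg (walkProb_nonneg _ _) (walkProb_nonneg _ _), mul_assoc, Finset.sum_mul]
    congr 1
    refine Finset.sum_congr rfl fun j _ => ?_
    rw [ENNReal.ofReal_add (walkProb_nonneg _ _) (walkProb_nonneg _ _), add_mul]
  have h2 : ∀ x, ENNReal.ofReal (walkProb d k x) * (ENNReal.ofReal (2 * d : ℝ)⁻¹ *
        ∑ j : Fin d, (g (x + Pi.single j 1) + g (x - Pi.single j 1))) =
      ENNReal.ofReal (2 * d : ℝ)⁻¹ * ∑ j : Fin d,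
        (ENNReal.ofReal (walkProb d k x) * g (x + Pi.single j 1)
          + ENNReal.ofReal (walkProb d k x) * g (x - Pi.single j 1)) := by
    intro x
    rw [mul_left_comm, Finset.mul_sum]
    simp only [mul_add]
  simp only [h1, h2, ENNReal.tsum_mul_left]
  congr 1
  rw [Summable.tsum_finsetSum fun _ _ => ENNReal.summable,
    Summable.tsum_finsetSum fun _ _ => ENNReal.summable]
  refine Finset.sum_congr rfl fun j _ => ?_
  rw [ENNReal.tsum_add, ENNReal.tsum_add, add_comm]
  congr 1
  · rw [← (Equiv.addRight (Pi.single j 1 : Lat d)).tsum_eq]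
    simp
  · rw [← (Equiv.subRight (Pi.single j 1 : Lat d)).tsum_eq]
    simp

lemma tsum_walkProb (hd : 1 ≤ d) (k : ℕ) : ∑' x : Lat d, ENNReal.ofReal (walkProb d k x) = 1 := by
  induction k with
  | zero =>
    rw [tsum_eq_single 0]
    · simp [walkProb]
    · intro x hx; simp [walkProb, hx]
  | succ k ih =>
    have h := tsum_walkProb_succ_mul (d := d) k fun _ => 1
    simp only [mul_one] at h
    rw [h, ENNReal.tsum_mul_right, ih, one_mul, Finset.sum_const, Finset.card_univ,
      Fintype.card_fin, nsmul_eq_mul, one_add_one_eq_two, ENNReal.ofReal_inv_of_pos (by positivity),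
      ENNReal.ofReal_mul (by norm_num), ENNReal.ofReal_natCast, ENNReal.ofReal_ofNat, mul_comm _ 2]
    refine ENNReal.inv_mul_cancel ?_ ?_
    · simp; omega
    · exact ENNReal.mul_ne_top (by simp) (by simp)

lemma tsum_walkProb_mul_latWeight (hd : 1 ≤ d) (k : ℕ) :
    ∑' x : Lat d, ENNReal.ofReal (walkProb d k x) * ENNReal.ofReal (latWeight x) = k + 1 := by
  induction k with
  | zero =>
    rw [tsum_eq_single 0]
    · simp [walkProb, latWeight]
    · intro x hx; simp [walkProb, hx]
  | succ k ih =>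
    rw [tsum_walkProb_succ_mul]
    have h : ∀ x : Lat d, ENNReal.ofReal (2 * d : ℝ)⁻¹ * ∑ j : Fin d,
        (ENNReal.ofReal (latWeight (x + Pi.single j 1))
          + ENNReal.ofReal (latWeight (x - Pi.single j 1))) =
        ENNReal.ofReal (latWeight x) + 1 := by
      intro x
      simp only [← ENNReal.ofReal_add (latWeight_pos _).le (latWeight_pos _).le,
        latWeight_add_single, Finset.sum_const, Finset.card_univ, Fintype.card_fin]
      rw [nsmul_eq_mul, ← ENNReal.ofReal_natCast, ← ENNReal.ofReal_mul (by positivity),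
        ← ENNReal.ofReal_mul (by positivity), ← ENNReal.ofReal_one,
        ← ENNReal.ofReal_add (latWeight_pos _).le zero_le_one]
      congr 1
      field_simp
    simp only [h, mul_add, mul_one, ENNReal.tsum_add, ih, tsum_walkProb hd]
    push_cast; rfl

lemma tsum_walkProb_mul_latWeight_rpow_le (hd : 1 ≤ d) (k : ℕ) {b : ℝ} (hb0 : 0 ≤ b)
    (hb1 : b ≤ 1) :
    ∑' x : Lat d, ENNReal.ofReal (walkProb d k x) * ENNReal.ofReal (latWeight x ^ b) ≤
      ENNReal.ofReal (2 * ((k : ℝ) + 1) ^ b) := by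
  set T : ℝ := (k : ℝ) + 1 with hT
  have hT0 : 0 < T := by positivity
  -- This is `y^b ≤ 1 + y` at `y = latWeight x / T`. As `T = k + 1` is the mean weight, averaging
  -- the right side gives `2 T^b`.
  have h : ∀ x : Lat d, latWeight x ^ b ≤ T ^ b * (1 + T⁻¹ * latWeight x) := by
    intro x
    have hx := latWeight_pos x
    have h1 : latWeight x ^ b = T ^ b * (T⁻¹ * latWeight x) ^ b := by
      rw [← Real.mul_rpow hT0.le (by positivity), mul_inv_cancel_left₀ hT0.ne']
    rw [h1]
    refine mul_le_mul_of_nonneg_left ?_ (by positivity)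
    have hy : 0 < T⁻¹ * latWeight x := by positivity
    rcases le_total (T⁻¹ * latWeight x) 1 with h | h
    · linarith [Real.rpow_le_one hy.le h hb0]
    · have := Real.rpow_le_rpow_of_exponent_le h hb1
      rw [Real.rpow_one] at this
      linarith
  calc ∑' x : Lat d, ENNReal.ofReal (walkProb d k x) * ENNReal.ofReal (latWeight x ^ b)
      ≤ ∑' x : Lat d, ENNReal.ofReal (walkProb d k x) * (ENNReal.ofReal (T ^ b) *
          (1 + ENNReal.ofReal T⁻¹ * ENNReal.ofReal (latWeight x))) := by
        gcongr with x
        have hx := latWeight_pos x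
        rw [← ENNReal.ofReal_mul (by positivity), ← ENNReal.ofReal_one,
          ← ENNReal.ofReal_add zero_le_one (by positivity), ← ENNReal.ofReal_mul (by positivity)]
        exact ENNReal.ofReal_le_ofReal (h x)
    _ = ENNReal.ofReal (T ^ b) * (∑' x : Lat d, ENNReal.ofReal (walkProb d k x) +
          ENNReal.ofReal T⁻¹ *
            ∑' x : Lat d, ENNReal.ofReal (walkProb d k x) * ENNReal.ofReal (latWeight x)) := by
        rw [← ENNReal.tsum_mul_left, ← ENNReal.tsum_add, ← ENNReal.tsum_mul_left]
        congr 1; ext x; ring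
    _ = ENNReal.ofReal (2 * T ^ b) := by
        have hk : (k : ℝ≥0∞) + 1 = ENNReal.ofReal T := by
          rw [hT, ENNReal.ofReal_add (by positivity) zero_le_one]; simp
        rw [tsum_walkProb hd, tsum_walkProb_mul_latWeight hd, hk, ← ENNReal.ofReal_mul (by positivity),
          inv_mul_cancel₀ hT0.ne', ENNReal.ofReal_one, mul_comm, one_add_one_eq_two,
          ENNReal.ofReal_mul (by norm_num)]
        simp

lemma matEl_fracLaplacian_translate (hd : 1 ≤ d) {α : ℝ} (h0 : 0 < α) (h1 : α < 1)
    (x y v : Lat d) :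
    matEl (fracLaplacian d α) (x + v) (y + v) = matEl (fracLaplacian d α) x y := by
  have h := tendsto_matEl_fracLaplacian hd h0 h1 (x + v) (y + v)
  rw [add_sub_add_right_eq_sub] at h
  exact tendsto_nhds_unique h (tendsto_matEl_fracLaplacian hd h0 h1 x y)

lemma enorm_matEl_fracLaplacian_le (hd : 1 ≤ d) {α : ℝ} (h0 : 0 < α) (h1 : α < 1) (x : Lat d) :
    ‖matEl (fracLaplacian d α) x 0‖ₑ ≤ ENNReal.ofReal ((2 * d : ℝ) ^ α) *
      ∑' k, ENNReal.ofReal |fracCoeff α k| * ENNReal.ofReal (walkProb d k x) := by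
  refine le_of_tendsto (tendsto_matEl_fracLaplacian hd h0 h1 x 0).enorm
    (Filter.Eventually.of_forall fun n => ?_)
  have h2 : ‖(2 * d : ℝ) ^ α * ∑ k ∈ Finset.range n, fracCoeff α k * walkProb d k (x - 0)‖ ≤
      (2 * d : ℝ) ^ α * ∑ k ∈ Finset.range n, |fracCoeff α k| * walkProb d k x := by
    rw [norm_mul, Real.norm_of_nonneg (by positivity), sub_zero]
    gcongr
    refine norm_sum_le_of_le _ fun k _ => ?_
    rw [norm_mul, Real.norm_eq_abs, Real.norm_of_nonneg (walkProb_nonneg k x)]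
  rw [← ofReal_norm, Complex.norm_real]
  refine (ENNReal.ofReal_le_ofReal h2).trans ?_
  rw [ENNReal.ofReal_mul (by positivity), ENNReal.ofReal_sum_of_nonneg
    fun k _ => mul_nonneg (abs_nonneg _) (walkProb_nonneg k x)]
  gcongr
  refine le_trans (le_of_eq ?_) (ENNReal.sum_le_tsum (Finset.range n))
  exact Finset.sum_congr rfl fun k _ => ENNReal.ofReal_mul (abs_nonneg _)

/-- Tonelli exchanges sites and walk lengths. The `k`-step moment is at most `2 (k+1)^b`, and
against coefficients of order `k^{-1-α}` this is summable because `b < α`. -/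
lemma tsum_enorm_matEl_fracLaplacian_mul_latWeight_lt_top (hd : 1 ≤ d) {α b : ℝ} (h0 : 0 < α)
    (h1 : α < 1) (hb0 : 0 ≤ b) (hb : b < α) :
    ∑' x : Lat d, ‖matEl (fracLaplacian d α) x 0‖ₑ * ENNReal.ofReal (latWeight x ^ b) < ∞ := by
  have hs := summable_abs_fracCoeff_mul_rpow h0 h1 hb
  calc ∑' x : Lat d, ‖matEl (fracLaplacian d α) x 0‖ₑ * ENNReal.ofReal (latWeight x ^ b)
      ≤ ∑' x : Lat d, (ENNReal.ofReal ((2 * d : ℝ) ^ α) *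
          ∑' k, ENNReal.ofReal |fracCoeff α k| * ENNReal.ofReal (walkProb d k x)) *
            ENNReal.ofReal (latWeight x ^ b) := by
        gcongr with x
        exact enorm_matEl_fracLaplacian_le hd h0 h1 x
    _ = ENNReal.ofReal ((2 * d : ℝ) ^ α) * ∑' k, ENNReal.ofReal |fracCoeff α k| *
          ∑' x : Lat d, ENNReal.ofReal (walkProb d k x) * ENNReal.ofReal (latWeight x ^ b) := by
        simp only [mul_assoc, ENNReal.tsum_mul_left, ← ENNReal.tsum_mul_right]
        rw [ENNReal.tsum_comm]
        simp only [← ENNReal.tsum_mul_left]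
    _ ≤ ENNReal.ofReal ((2 * d : ℝ) ^ α) * ∑' k : ℕ,
          ENNReal.ofReal (2 * (|fracCoeff α k| * ((k : ℝ) + 1) ^ b)) := by
        gcongr with k
        refine (mul_le_mul_right (tsum_walkProb_mul_latWeight_rpow_le hd k hb0
          (hb.le.trans h1.le)) _).trans_eq ?_
        rw [← ENNReal.ofReal_mul (abs_nonneg _)]
        congr 1; ring
    _ < ∞ := by
        rw [← ENNReal.ofReal_tsum_of_nonneg (fun k => by positivity) (hs.mul_left 2)]
        exact ENNReal.mul_lt_top ENNReal.ofReal_lt_top ENNReal.ofReal_lt_top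

lemma tsum_pi_prod (f : ℤ → ℝ≥0∞) (n : ℕ) :
    ∑' x : Fin n → ℤ, ∏ i, f (x i) = (∑' m, f m) ^ n := by
  induction n with
  | zero => rw [tsum_fintype]; simp
  | succ n ih =>
    rw [← (Fin.consEquiv fun _ => ℤ).tsum_eq, ENNReal.tsum_prod', pow_succ', ← ih,
      ← ENNReal.tsum_mul_right]
    refine tsum_congr fun m => ?_
    rw [← ENNReal.tsum_mul_left]
    refine tsum_congr fun x => ?_
    rw [Fin.prod_univ_succ]
    simp [Fin.consEquiv]

/-- The weight dominates each `1 + x_i²`, hence also the product of their `d`-th roots. The sum is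
thus bounded by a product of one-dimensional sums, each finite because `2q/d > 1`. -/
lemma tsum_latWeight_rpow_lt_top (hd : 1 ≤ d) {q : ℝ} (hq : (d : ℝ) / 2 < q) :
    ∑' x : Lat d, ENNReal.ofReal (latWeight x ^ (-q)) < ∞ := by
  have hd0 : (0 : ℝ) < d := by positivity
  have hs : Summable fun m : ℤ => (1 + (m : ℝ) ^ 2) ^ (-(q / d)) := by
    have h1 : 1 < 2 * (q / d) := by
      rw [mul_div_assoc', lt_div_iff₀ hd0]; linarith
    refine (Real.summable_abs_int_rpow h1).of_norm_bounded_eventually ?_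
    rw [Filter.eventually_cofinite]
    refine (Set.finite_singleton (0 : ℤ)).subset fun m hm => ?_
    by_contra hm0
    refine hm ?_
    have h2 : (0 : ℝ) < |(m : ℝ)| := abs_pos.2 (Int.cast_ne_zero.2 hm0)
    rw [Real.norm_of_nonneg (by positivity), ← mul_neg, Real.rpow_mul h2.le, Real.rpow_two, sq_abs]
    refine Real.rpow_le_rpow_of_nonpos (by rw [← sq_abs]; positivity) (by linarith) ?_
    have : 0 < q / d := by linarith
    linarith
  have hf : ∀ x : Lat d, ENNReal.ofReal (latWeight x ^ (-q)) ≤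
      ∏ i, ENNReal.ofReal ((1 + (x i : ℝ) ^ 2) ^ (-(q / d))) := by
    intro x
    rw [← ENNReal.ofReal_prod_of_nonneg fun i _ => by positivity]
    refine ENNReal.ofReal_le_ofReal ?_
    have h1 : latWeight x ^ (-q) = ∏ _i : Fin d, latWeight x ^ (-(q / d)) := by
      rw [Finset.prod_const, Finset.card_univ, Fintype.card_fin, ← Real.rpow_mul_natCast
        (latWeight_pos x).le]
      congr 1
      field_simp
    rw [h1]
    refine Finset.prod_le_prod (fun i _ => Real.rpow_nonneg (latWeight_pos x).le _) fun i _ => ?_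
    refine Real.rpow_le_rpow_of_nonpos (by positivity) ?_ ?_
    · rw [latWeight]
      have := Finset.single_le_sum (f := fun i => (x i : ℝ) ^ 2) (fun j _ => sq_nonneg _)
        (Finset.mem_univ i)
      linarith
    · have : 0 < q / d := div_pos (by linarith) hd0
      linarith
  refine (ENNReal.tsum_le_tsum hf).trans_lt ?_
  rw [tsum_pi_prod fun m => ENNReal.ofReal ((1 + (m : ℝ) ^ 2) ^ (-(q / d))),
    ← ENNReal.ofReal_tsum_of_nonneg (fun m => by positivity) hs]
  exact ENNReal.pow_lt_top ENNReal.ofReal_lt_top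

lemma kernelD_translate (hd : 1 ≤ d) {α : ℝ} (h0 : 0 < α) (h1 : α < 1) (s : ℝ) (x y v : Lat d) :
    kernelD d α s (x + v) (y + v) = kernelD d α s x y := by
  rw [kernelD, kernelD, matEl_fracLaplacian_translate hd h0 h1]

/-- Young's inequality with weights `s` and `1 - s` is applied to `K w^b` and `w^{-bs/(1-s)}`, whose
weighted geometric mean is `K^s`. Both are summable if `b < α` and `bs/(1-s) > d/2`. Such a `b`
exists exactly when `d(1-s)/(2s) < α`, that is, `s > d/(d+2α)`. -/
lemma tsum_kernelD_zero_lt_top (hd : 1 ≤ d) {α s : ℝ} (h0 : 0 < α) (h1 : α < 1)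
    (hs0 : (d : ℝ) / (d + 2 * α) < s) (hs1 : s < 1) :
    ∑' x : Lat d, (kernelD d α s x 0 : ℝ≥0∞) < ∞ := by
  have hd0 : (0 : ℝ) < d := by positivity
  have hs : 0 < s := (by positivity : (0 : ℝ) ≤ d / (d + 2 * α)).trans_lt hs0
  have hs2 : d * (1 - s) / (2 * s) < α := by
    rw [div_lt_iff₀ (by positivity)] at hs0 ⊢
    linarith
  obtain ⟨b, hb, hbα⟩ := exists_between hs2
  have hb0 : 0 ≤ b := (div_nonneg (mul_nonneg hd0.le (by linarith)) (by positivity)).trans hb.le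
  have hq : (d : ℝ) / 2 < b * s / (1 - s) := by
    rw [div_lt_iff₀ (by positivity)] at hb
    rw [div_lt_div_iff₀ (by norm_num) (by linarith)]
    linarith
  have key : ∀ x : Lat d, (kernelD d α s x 0 : ℝ≥0∞) ≤
      ‖matEl (fracLaplacian d α) x 0‖ₑ * ENNReal.ofReal (latWeight x ^ b) +
        ENNReal.ofReal (latWeight x ^ (-(b * s / (1 - s)))) := by
    intro x
    have hx := latWeight_pos x
    set K := ‖matEl (fracLaplacian d α) x 0‖ with hK
    have hK0 : 0 ≤ K := norm_nonneg _
    have e : (kernelD d α s x 0 : ℝ≥0∞) = ENNReal.ofReal (K ^ s) := by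
      rw [kernelD, hK, ← coe_nnnorm, ← NNReal.coe_rpow, ENNReal.ofReal_coe_nnreal]
    rw [e, ← ofReal_norm, ← hK, ← ENNReal.ofReal_mul hK0, ← ENNReal.ofReal_add (by positivity)
      (by positivity)]
    refine ENNReal.ofReal_le_ofReal ?_
    have y := Real.geom_mean_le_arith_mean2_weighted (w₁ := s) (w₂ := 1 - s)
      (p₁ := K * latWeight x ^ b) (p₂ := latWeight x ^ (-(b * s / (1 - s)))) hs.le (by linarith)
      (by positivity) (by positivity) (by ring)
    have e2 : (K * latWeight x ^ b) ^ s * (latWeight x ^ (-(b * s / (1 - s)))) ^ (1 - s) =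
        K ^ s := by
      rw [Real.mul_rpow hK0 (by positivity), ← Real.rpow_mul hx.le, ← Real.rpow_mul hx.le,
        mul_assoc, ← Real.rpow_add hx]
      have : b * s + -(b * s / (1 - s)) * (1 - s) = 0 := by
        have : 1 - s ≠ 0 := by linarith
        field_simp; ring
      rw [this, Real.rpow_zero, mul_one]
    rw [e2] at y
    refine y.trans (add_le_add ?_ ?_)
    · exact mul_le_of_le_one_left (by positivity) hs1.le
    · exact mul_le_of_le_one_left (by positivity) (by linarith)
  refine (ENNReal.tsum_le_tsum key).trans_lt ?_
  rw [ENNReal.tsum_add]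
  exact ENNReal.add_lt_top.2 ⟨tsum_enorm_matEl_fracLaplacian_mul_latWeight_lt_top hd h0 h1 hb0 hbα,
    tsum_latWeight_rpow_lt_top hd hq⟩

lemma tsum_kernelD_eq (hd : 1 ≤ d) {α : ℝ} (h0 : 0 < α) (h1 : α < 1) (s : ℝ) (u : Lat d) :
    ∑' y : Lat d, (kernelD d α s u y : ℝ≥0∞) = ∑' x : Lat d, (kernelD d α s x 0 : ℝ≥0∞) := by
  rw [← (Equiv.subLeft u).tsum_eq]
  refine tsum_congr fun y => ?_
  rw [← kernelD_translate hd h0 h1 s y 0 (Equiv.subLeft u y)]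
  simp

end FracAnderson

namespace FracAnderson

/-! ### Depleted resolvents -/

variable {d : ℕ}

lemma isSelfAdjoint_mulOp {v : Lat d → ℝ} (hv : ∃ C, ∀ x, |v x| ≤ C) :
    IsSelfAdjoint (mulOp v) := by
  rw [ContinuousLinearMap.isSelfAdjoint_iff_isSymmetric]
  intro f g
  change ⟪mulOp v f, g⟫_ℂ = ⟪f, mulOp v g⟫_ℂ
  rw [Ell2.inner_eq_tsum, Ell2.inner_eq_tsum]
  refine tsum_congr fun x => ?_
  rw [mulOp_apply hv, mulOp_apply hv, RCLike.inner_apply, RCLike.inner_apply, map_mul,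
    Complex.conj_ofReal]
  ring

lemma exists_bound_update {v : Lat d → ℝ} (hv : ∃ C, ∀ x, |v x| ≤ C) (u : Lat d) (t : ℝ) :
    ∃ C, ∀ x, |Function.update v u t x| ≤ C := by
  obtain ⟨C, hC⟩ := hv
  refine ⟨max C |t|, fun x => ?_⟩
  rcases eq_or_ne x u with rfl | h
  · simp
  · rw [Function.update_of_ne h]; exact (hC x).trans (le_max_left _ _)

/-- The orthogonal projection onto the sequences vanishing on `F`. -/
noncomputable def siteProj (F : Set (Lat d)) : Ell2 d →L[ℂ] Ell2 d :=
  mulOp (Fᶜ.indicator fun _ => (1 : ℝ))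

lemma exists_bound_indicator (F : Set (Lat d)) :
    ∃ C, ∀ x, |Fᶜ.indicator (fun _ => (1 : ℝ)) x| ≤ C := by
  refine ⟨1, fun x => ?_⟩
  by_cases h : x ∈ Fᶜ <;> simp [h]

lemma siteProj_apply_of_mem {F : Set (Lat d)} (f : Ell2 d) {x : Lat d} (hx : x ∈ F) :
    siteProj F f x = 0 := by
  rw [siteProj, mulOp_apply (exists_bound_indicator F), Set.indicator_of_notMem (by simpa using hx)]
  simp

lemma siteProj_apply_of_notMem {F : Set (Lat d)} (f : Ell2 d) {x : Lat d} (hx : x ∉ F) :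
    siteProj F f x = f x := by
  rw [siteProj, mulOp_apply (exists_bound_indicator F), Set.indicator_of_mem (by simpa using hx)]
  simp

lemma siteProj_eq_self {F : Set (Lat d)} {f : Ell2 d} (hf : ∀ x ∈ F, f x = 0) :
    siteProj F f = f := by
  ext x
  by_cases hx : x ∈ F
  · rw [siteProj_apply_of_mem f hx, hf x hx]
  · exact siteProj_apply_of_notMem f hx

/-- The operator `A + v` with the sites of `F` removed. -/
noncomputable def depletedOp (A : Ell2 d →L[ℂ] Ell2 d) (v : Lat d → ℝ) (F : Set (Lat d)) :
    Ell2 d →L[ℂ] Ell2 d :=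
  siteProj F * (A + mulOp v) * siteProj F

lemma depletedOp_apply (A : Ell2 d →L[ℂ] Ell2 d) (v : Lat d → ℝ) (F : Set (Lat d)) (f : Ell2 d) :
    depletedOp A v F f = siteProj F (A (siteProj F f) + mulOp v (siteProj F f)) := rfl

lemma depletedOp_apply_of_notMem (A : Ell2 d →L[ℂ] Ell2 d) {v : Lat d → ℝ}
    (hv : ∃ C, ∀ x, |v x| ≤ C) {F : Set (Lat d)} (f : Ell2 d) {x : Lat d} (hx : x ∉ F) :
    depletedOp A v F f x = A (siteProj F f) x + v x * f x := by
  rw [depletedOp_apply, siteProj_apply_of_notMem _ hx, Ell2.add_apply, mulOp_apply hv,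
    siteProj_apply_of_notMem _ hx]

lemma depletedOp_apply_of_mem (A : Ell2 d →L[ℂ] Ell2 d) (v : Lat d → ℝ) {F : Set (Lat d)}
    (f : Ell2 d) {x : Lat d} (hx : x ∈ F) : depletedOp A v F f x = 0 :=
  siteProj_apply_of_mem _ hx

lemma depletedOp_empty (A : Ell2 d →L[ℂ] Ell2 d) (v : Lat d → ℝ) :
    depletedOp A v ∅ = A + mulOp v := by
  have h : siteProj (∅ : Set (Lat d)) = 1 := by
    ext f x
    exact siteProj_apply_of_notMem f (Set.notMem_empty x)
  rw [depletedOp, h, one_mul, mul_one]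

lemma isSelfAdjoint_depletedOp {A : Ell2 d →L[ℂ] Ell2 d} (hA : IsSelfAdjoint A) {v : Lat d → ℝ}
    (hv : ∃ C, ∀ x, |v x| ≤ C) (F : Set (Lat d)) : IsSelfAdjoint (depletedOp A v F) := by
  have hQ : IsSelfAdjoint (siteProj F) := isSelfAdjoint_mulOp (exists_bound_indicator F)
  have h := (hA.add (isSelfAdjoint_mulOp hv)).conjugate (siteProj F)
  rwa [hQ.star_eq] at h

/-! ### Resolvents of self-adjoint operators off the real axis. -/

section Resolvent

variable {E : Type*} [NormedAddCommGroup E] [InnerProductSpace ℂ E] [CompleteSpace E]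

lemma isUnit_sub_smul_id {T : E →L[ℂ] E} (hT : IsSelfAdjoint T) {z : ℂ} (hz : z.im ≠ 0) :
    IsUnit (T - z • ContinuousLinearMap.id ℂ E) := by
  by_contra h
  have h1 : z ∈ spectrum ℂ T := by
    rw [spectrum.mem_iff, IsUnit.sub_iff]
    exact h
  have h2 := hT.mem_spectrum_eq_re h1
  exact hz (by rw [h2, Complex.ofReal_im])

/-- The form `⟪f, T f⟫` is real, so the imaginary part of `⟪f, (T - z) f⟫` is `-Im z ‖f‖²`;
Cauchy–Schwarz concludes. -/
lemma abs_im_mul_norm_le {T : E →L[ℂ] E} (hT : IsSelfAdjoint T) (z : ℂ) (f : E) :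
    |z.im| * ‖f‖ ≤ ‖(T - z • ContinuousLinearMap.id ℂ E) f‖ := by
  have h1 : (⟪f, (T - z • ContinuousLinearMap.id ℂ E) f⟫_ℂ).im = -(z.im * ‖f‖ ^ 2) := by
    have h2 : (⟪f, T f⟫_ℂ).im = 0 := by
      have h3 := (ContinuousLinearMap.isSelfAdjoint_iff_isSymmetric.1 hT).coe_re_inner_self_apply f
      have h4 : ((⟪f, T f⟫_ℂ).re : ℂ) = ⟪f, T f⟫_ℂ := by
        rw [← inner_conj_symm]
        have h5 : ⟪T f, f⟫_ℂ = ⟪f, T f⟫_ℂ :=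
          ContinuousLinearMap.isSelfAdjoint_iff_isSymmetric.1 hT f f
        rw [h5]
        refine Complex.ext (by simp) ?_
        have h6 := congrArg Complex.im (inner_conj_symm f (T f))
        rw [h5, Complex.conj_im] at h6
        simp only [Complex.ofReal_im, Complex.conj_im]
        linarith
      rw [← h4, Complex.ofReal_im]
    rw [sub_apply, inner_sub_right, Complex.sub_im, h2, smul_apply, inner_smul_right,
      ContinuousLinearMap.id_apply, inner_self_eq_norm_sq_to_K]
    simp [← Complex.ofReal_pow]
  have h2 := (Complex.abs_im_le_norm _).trans
    (norm_inner_le_norm (𝕜 := ℂ) f ((T - z • ContinuousLinearMap.id ℂ E) f))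
  rw [h1, abs_neg, abs_mul, abs_of_nonneg (sq_nonneg ‖f‖)] at h2
  rcases (norm_nonneg f).eq_or_lt with h0 | h0
  · rw [← h0, mul_zero]; exact norm_nonneg _
  · refine le_of_mul_le_mul_left ?_ h0
    linarith

end Resolvent

/-- The resolvent of the depleted operator. -/
noncomputable def depletedRes (A : Ell2 d →L[ℂ] Ell2 d) (v : Lat d → ℝ) (F : Set (Lat d)) (z : ℂ) :
    Ell2 d →L[ℂ] Ell2 d :=
  Ring.inverse (depletedOp A v F - z • ContinuousLinearMap.id ℂ (Ell2 d))

section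

variable {A : Ell2 d →L[ℂ] Ell2 d} (hA : IsSelfAdjoint A) {v : Lat d → ℝ}
  (hv : ∃ C, ∀ x, |v x| ≤ C) (F : Set (Lat d)) {z : ℂ} (hz : z.im ≠ 0)

include hA hv hz

lemma depletedOp_depletedRes (f : Ell2 d) :
    depletedOp A v F (depletedRes A v F z f) - z • depletedRes A v F z f = f := by
  have h := Ring.mul_inverse_cancel _ (isUnit_sub_smul_id (isSelfAdjoint_depletedOp hA hv F) hz)
  exact DFunLike.congr_fun h f

lemma depletedRes_depletedOp (f : Ell2 d) :
    depletedRes A v F z (depletedOp A v F f - z • f) = f := by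
  have h := Ring.inverse_mul_cancel _ (isUnit_sub_smul_id (isSelfAdjoint_depletedOp hA hv F) hz)
  exact DFunLike.congr_fun h f

lemma norm_depletedRes_apply_le (f : Ell2 d) :
    ‖depletedRes A v F z f‖ ≤ |z.im|⁻¹ * ‖f‖ := by
  have h := abs_im_mul_norm_le (isSelfAdjoint_depletedOp hA hv F) z (depletedRes A v F z f)
  rw [le_inv_mul_iff₀ (abs_pos.2 hz)]
  refine h.trans_eq ?_
  congr 1
  exact depletedOp_depletedRes hA hv F hz f

lemma norm_matEl_depletedRes_le (x y : Lat d) : ‖matEl (depletedRes A v F z) x y‖ ≤ |z.im|⁻¹ := by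
  refine (Ell2.norm_apply_le _ _).trans ((norm_depletedRes_apply_le hA hv F hz _).trans_eq ?_)
  rw [Ell2.norm_delta, mul_one]

/-- The depleted operator acts on the whole space and is `0` on `F`, so at `y ∈ F` the resolvent
equation reads `-z` times the entry equals `δ_x(y) = 0`. -/
lemma matEl_depletedRes_of_mem {F : Set (Lat d)} {x y : Lat d} (hx : x ∉ F) (hy : y ∈ F) :
    matEl (depletedRes A v F z) y x = 0 := by
  have h := congrArg (fun f : Ell2 d => f y) (depletedOp_depletedRes hA hv F hz (Ell2.delta x))
  simp only [Ell2.sub_apply, Ell2.smul_apply, depletedOp_apply_of_mem _ _ _ hy] at h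
  rw [Ell2.delta_apply, if_neg fun e : y = x => hx (e ▸ hy), zero_sub, neg_eq_zero] at h
  refine (mul_eq_zero.1 h).resolve_left fun h0 => hz ?_
  rw [h0, Complex.zero_im]

/-- The column `φ` of the resolvent with `u` also removed vanishes on `insert u F`. Hence `H_F - z`
maps it to `δ_x` plus an error located at `u`, equal to `(A φ)(u)`; the potential at `u` does not
enter. Applying the resolvent of `H_F` and evaluating at `u`, where `φ` is zero, gives the identity.
-/
lemma matEl_depletedRes_eq {F : Set (Lat d)} {u x : Lat d} (hu : u ∉ F) (hx : x ∉ F)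
    (hxu : x ≠ u) :
    matEl (depletedRes A v F z) u x = -(matEl (depletedRes A v F z) u u *
      A (depletedRes A v (insert u F) z (Ell2.delta x)) u) := by
  set φ := depletedRes A v (insert u F) z (Ell2.delta x) with hφ
  have hx' : x ∉ insert u F := by simp [hx, hxu]
  have h0 : ∀ y ∈ insert u F, φ y = 0 := fun y hy => matEl_depletedRes_of_mem hA hv hz hx' hy
  have h0F : ∀ y ∈ F, φ y = 0 := fun y hy => h0 y (Set.mem_insert_of_mem u hy)
  have h1 : depletedOp A v F φ - z • φ = Ell2.delta x + A φ u • Ell2.delta u := by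
    rw [← depletedOp_depletedRes hA hv (insert u F) hz (Ell2.delta x), ← hφ, sub_add_eq_add_sub]
    congr 1
    ext y
    rw [Ell2.add_apply, Ell2.smul_apply, Ell2.delta_apply]
    rcases eq_or_ne y u with rfl | hyu
    · rw [depletedOp_apply_of_notMem A hv _ hu, siteProj_eq_self h0F, h0 y (Set.mem_insert _ _),
        depletedOp_apply_of_mem _ _ _ (Set.mem_insert _ _), if_pos rfl]
      simp
    · rw [if_neg hyu, mul_zero, add_zero]
      by_cases hy : y ∈ F
      · rw [depletedOp_apply_of_mem _ _ _ hy,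
          depletedOp_apply_of_mem _ _ _ (Set.mem_insert_of_mem u hy)]
      · rw [depletedOp_apply_of_notMem A hv _ hy,
          depletedOp_apply_of_notMem A hv _ (by simp [hy, hyu]), siteProj_eq_self h0F,
          siteProj_eq_self h0]
  have h2 := congrArg (fun f => depletedRes A v F z f u) h1
  simp only [depletedRes_depletedOp hA hv F hz, map_add, map_smul, Ell2.add_apply,
    Ell2.smul_apply] at h2
  rw [h0 u (Set.mem_insert _ _)] at h2
  rw [matEl, matEl]
  linear_combination -h2

/-- Changing the potential at one site is a rank-one perturbation. The multiplied-out form avoids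
discussing whether the denominator vanishes. -/
lemma matEl_depletedRes_update_mul {F : Set (Lat d)} {u : Lat d} (hu : u ∉ F) (t : ℝ) :
    matEl (depletedRes A (Function.update v u t) F z) u u *
      (1 + t * matEl (depletedRes A (Function.update v u 0) F z) u u) =
        matEl (depletedRes A (Function.update v u 0) F z) u u := by
  have ht := exists_bound_update hv u t
  have h0 := exists_bound_update hv u 0
  set ψ := depletedRes A (Function.update v u t) F z (Ell2.delta u) with hψ
  have h1 : depletedOp A (Function.update v u 0) F ψ - z • ψ =
      (1 - t * ψ u) • Ell2.delta u := by
    rw [sub_smul, one_smul]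
    nth_rw 1 [← depletedOp_depletedRes hA ht F hz (Ell2.delta u)]
    rw [← hψ, sub_right_comm]
    congr 1
    ext y
    rw [Ell2.sub_apply, Ell2.smul_apply, Ell2.delta_apply]
    by_cases hy : y ∈ F
    · rw [depletedOp_apply_of_mem _ _ _ hy, depletedOp_apply_of_mem _ _ _ hy,
        if_neg fun e : y = u => hu (e ▸ hy)]
      simp
    · rw [depletedOp_apply_of_notMem A h0 _ hy, depletedOp_apply_of_notMem A ht _ hy]
      rcases eq_or_ne y u with rfl | hyu
      · simp
      · simp [hyu]
  have h2 := congrArg (fun f => depletedRes A (Function.update v u 0) F z f u) h1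
  simp only [depletedRes_depletedOp hA h0 F hz, map_smul, Ell2.smul_apply] at h2
  change ψ u * (1 + t * depletedRes A (Function.update v u 0) F z (Ell2.delta u) u) =
    depletedRes A (Function.update v u 0) F z (Ell2.delta u) u
  linear_combination h2

omit hA hz in
lemma depletedRes_update_of_mem {F : Set (Lat d)} {u : Lat d} (hu : u ∈ F) (t : ℝ) :
    depletedRes A (Function.update v u t) F z = depletedRes A v F z := by
  have h : depletedOp A (Function.update v u t) F = depletedOp A v F := by
    ext f y
    by_cases hy : y ∈ F
    · rw [depletedOp_apply_of_mem _ _ _ hy, depletedOp_apply_of_mem _ _ _ hy]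
    · rw [depletedOp_apply_of_notMem A hv _ hy,
        depletedOp_apply_of_notMem A (exists_bound_update hv u t) _ hy,
        Function.update_of_ne fun e : y = u => hy (e ▸ hu)]
  rw [depletedRes, h, depletedRes]

end

/-- Only strong continuity is claimed: pointwise convergence of potentials need not be uniform over
sites. The common bound `B` dominates the series for the squared norm. -/
lemma continuous_mulOp_apply {X : Type*} [TopologicalSpace X] {v : X → Lat d → ℝ} {B : ℝ}
    (hv : ∀ ω x, |v ω x| ≤ B) (hc : ∀ x, Continuous fun ω => v ω x) (f : Ell2 d) :
    Continuous fun ω => mulOp (v ω) f := by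
  rw [continuous_iff_continuousAt]
  intro ω₀
  have h1 : Continuous fun ω => ∑' x, |v ω x - v ω₀ x| ^ 2 * ‖f x‖ ^ 2 := by
    refine continuous_tsum (u := fun x => (2 * B) ^ 2 * ‖f x‖ ^ 2)
      (fun x => (((hc x).sub continuous_const).abs.pow 2).mul continuous_const)
      (f.summable_sq.mul_left _) fun x ω => ?_
    rw [Real.norm_of_nonneg (by positivity)]
    gcongr
    refine (abs_sub _ _).trans ?_
    linarith [hv ω x, hv ω₀ x]
  have h2 : ∀ ω, ‖mulOp (v ω) f - mulOp (v ω₀) f‖ ^ 2 =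
      ∑' x, |v ω x - v ω₀ x| ^ 2 * ‖f x‖ ^ 2 := by
    intro ω
    rw [Ell2.norm_sq_eq_tsum]
    refine tsum_congr fun x => ?_
    rw [Ell2.sub_apply, mulOp_apply ⟨B, hv ω⟩, mulOp_apply ⟨B, hv ω₀⟩, ← sub_mul, norm_mul,
      ← Complex.ofReal_sub, Complex.norm_real, mul_pow, Real.norm_eq_abs]
  have h3 := (h1.tendsto ω₀).sqrt
  simp only [← h2, Real.sqrt_sq (norm_nonneg _), sub_self, abs_zero, ne_eq, OfNat.ofNat_ne_zero,
    not_false_eq_true, zero_pow, zero_mul, tsum_zero, Real.sqrt_zero] at h3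
  rw [ContinuousAt, tendsto_iff_norm_sub_tendsto_zero]
  exact h3

/-- By the second resolvent identity, with the fixed vector `g` on the right, the bound `|Im z|⁻¹`
reduces the claim to strong continuity of the operators. It serves to obtain measurability in `ω`.
-/
lemma continuous_matEl_depletedRes {X : Type*} [TopologicalSpace X] {A : Ell2 d →L[ℂ] Ell2 d}
    (hA : IsSelfAdjoint A) {v : X → Lat d → ℝ} {B : ℝ} (hv : ∀ ω x, |v ω x| ≤ B)
    (hc : ∀ x, Continuous fun ω => v ω x) (F : Set (Lat d)) {z : ℂ} (hz : z.im ≠ 0)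
    (x y : Lat d) : Continuous fun ω => matEl (depletedRes A (v ω) F z) x y := by
  have hb : ∀ ω, ∃ C, ∀ x, |v ω x| ≤ C := fun ω => ⟨B, hv ω⟩
  refine (Ell2.eval x).continuous.comp (g := Ell2.eval x)
    (f := fun ω => depletedRes A (v ω) F z (Ell2.delta y)) ?_
  rw [continuous_iff_continuousAt]
  intro ω₀
  set g := depletedRes A (v ω₀) F z (Ell2.delta y) with hg
  have h1 : Continuous fun ω => depletedOp A (v ω) F g := by
    simp only [depletedOp_apply]
    exact (siteProj F).continuous.comp (continuous_const.add (continuous_mulOp_apply hv hc _))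
  have h2 : ∀ ω, depletedRes A (v ω) F z (Ell2.delta y) - g =
      depletedRes A (v ω) F z (depletedOp A (v ω₀) F g - depletedOp A (v ω) F g) := by
    intro ω
    have e : depletedOp A (v ω₀) F g - depletedOp A (v ω) F g =
        Ell2.delta y - (depletedOp A (v ω) F g - z • g) := by
      rw [← depletedOp_depletedRes hA (hb ω₀) F hz (Ell2.delta y), ← hg]; abel
    rw [e, map_sub, depletedRes_depletedOp hA (hb ω) F hz]
  rw [ContinuousAt, tendsto_iff_norm_sub_tendsto_zero]
  have h3 : Filter.Tendsto
      (fun ω => |z.im|⁻¹ * ‖depletedOp A (v ω₀) F g - depletedOp A (v ω) F g‖) (nhds ω₀)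
      (nhds 0) := by
    have := ((continuous_const (y := depletedOp A (v ω₀) F g)).sub h1).norm.tendsto ω₀
    simpa using this.const_mul |z.im|⁻¹
  refine squeeze_zero (fun ω => norm_nonneg _) (fun ω => ?_) h3
  rw [h2]
  exact norm_depletedRes_apply_le hA (hb ω) F hz _

end FracAnderson

namespace FracAnderson

lemma ENNReal_rpow_tsum_le {ι : Type*} (a : ι → ℝ≥0∞) {s : ℝ} (hs0 : 0 < s) (hs1 : s ≤ 1) :
    (∑' i, a i) ^ s ≤ ∑' i, a i ^ s := by
  classical
  have h : ∀ t : Finset ι, (∑ i ∈ t, a i) ^ s ≤ ∑ i ∈ t, a i ^ s := by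
    intro t
    induction t using Finset.induction_on with
    | empty => simp [hs0]
    | insert i t hi ih =>
      rw [Finset.sum_insert hi, Finset.sum_insert hi]
      exact (ENNReal.rpow_add_le_add_rpow _ _ hs0.le hs1).trans (add_le_add le_rfl ih)
  refine le_of_tendsto ((ENNReal.continuous_rpow_const.tendsto _).comp
    (ENNReal.summable (f := a)).hasSum) (Filter.Eventually.of_forall fun t => ?_)
  exact (h t).trans (ENNReal.sum_le_tsum t)

/-! ### Fractional moments of regular measures -/

/-- The set `{f > y}` lies, up to a null set, in the interval of radius `y^{-1/s}` about `b`, so its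
measure is at most `min(1, C y^{-τ/s})`. The tail is integrable because `s < τ`. -/
lemma lintegral_le_of_isRegConst {μ : Measure ℝ} [IsProbabilityMeasure μ] {τ C s b : ℝ}
    (hC : IsRegConst μ τ C) (hs0 : 0 < s) (hs1 : s < τ) {f : ℝ → ℝ} (hf0 : ∀ t, 0 ≤ f t)
    (hfm : AEMeasurable f μ) (hf : ∀ᵐ t ∂μ, f t * |t - b| ^ s ≤ 1) :
    ∫⁻ t, ENNReal.ofReal (f t) ∂μ ≤ ENNReal.ofReal (τ / (τ - s) * C ^ (s / τ)) := by
  obtain ⟨hC0, hC⟩ := hC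
  have hτ : 0 < τ := hs0.trans hs1
  -- At level `T` the two bounds `1` and `C y^{-τ/s}` agree; the integrals below and above it sum to
  -- `T + T s/(τ-s)`.
  set T : ℝ := C ^ (s / τ) with hT
  have hT0 : 0 < T := by positivity
  rw [lintegral_eq_lintegral_meas_lt μ (Filter.Eventually.of_forall hf0) hfm]
  have h1 : ∀ y ∈ Set.Ioi (0 : ℝ), μ {t | y < f t} ≤ ENNReal.ofReal (C * y ^ (-(τ / s))) := by
    intro y hy
    have hy0 : 0 < y := hy
    have h2 : μ {t | y < f t} ≤ μ (Set.Icc (b - y ^ (-s⁻¹)) (b + y ^ (-s⁻¹))) := by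
      refine measure_mono_ae ?_
      filter_upwards [hf] with t ht hyt
      have hyt' : y < f t := hyt
      have h3 : |t - b| ≤ y ^ (-s⁻¹) := by
        have h4 : y * |t - b| ^ s ≤ 1 :=
          (mul_le_mul_of_nonneg_right hyt'.le (by positivity)).trans ht
        have h5 : |t - b| ^ s ≤ y⁻¹ := by
          rw [← one_div, le_div_iff₀ hy0]; linarith
        have h6 := Real.rpow_le_rpow (by positivity) h5 (inv_nonneg.2 hs0.le)
        rwa [Real.rpow_rpow_inv (abs_nonneg _) hs0.ne', Real.inv_rpow hy0.le,
          ← Real.rpow_neg hy0.le] at h6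
      have := abs_le.1 h3
      exact ⟨by linarith, by linarith⟩
    refine h2.trans ((hC b _ (by positivity)).trans_eq ?_)
    rw [← Real.rpow_mul hy0.le]
    congr 3
    field_simp
  have hτs : -(τ / s) < -1 := by
    rw [neg_lt_neg_iff, lt_div_iff₀ hs0]; linarith
  have h2 : ∫⁻ y in Set.Ioi T, ENNReal.ofReal (C * y ^ (-(τ / s))) =
      ENNReal.ofReal (T * (s / (τ - s))) := by
    rw [← ofReal_integral_eq_lintegral_ofReal
      ((integrableOn_Ioi_rpow_of_lt hτs hT0).const_mul C)
      ((ae_restrict_iff' measurableSet_Ioi).2 (Filter.Eventually.of_forall fun y hy => by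
        have : 0 < y := hT0.trans hy
        positivity)), integral_const_mul, integral_Ioi_rpow_of_lt hτs hT0]
    congr 1
    have h3 : C * T ^ (-(τ / s)) = 1 := by
      rw [hT, ← Real.rpow_mul hC0.le, mul_neg, div_mul_div_cancel₀ hτ.ne', div_self hs0.ne',
        Real.rpow_neg_one, mul_inv_cancel₀ hC0.ne']
    rw [Real.rpow_add hT0, Real.rpow_one]
    have h4 : τ - s ≠ 0 := by linarith
    have h5 : -(τ / s) + 1 = -((τ - s) / s) := by field_simp; ring
    rw [h5, neg_div_neg_eq, ← mul_div_assoc, ← mul_assoc, h3, one_mul]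
    field_simp
  calc ∫⁻ y in Set.Ioi 0, μ {t | y < f t}
      = (∫⁻ y in Set.Ioc 0 T, μ {t | y < f t}) + ∫⁻ y in Set.Ioi T, μ {t | y < f t} := by
        rw [← lintegral_union measurableSet_Ioi (Set.Ioc_disjoint_Ioi le_rfl),
          Set.Ioc_union_Ioi_eq_Ioi hT0.le]
    _ ≤ (∫⁻ _ in Set.Ioc 0 T, 1) + ∫⁻ y in Set.Ioi T, ENNReal.ofReal (C * y ^ (-(τ / s))) := by
        refine add_le_add (lintegral_mono fun y => prob_le_one) ?_
        exact setLIntegral_mono' measurableSet_Ioi fun y hy => h1 y (hT0.trans hy)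
    _ = ENNReal.ofReal (τ / (τ - s) * T) := by
        have h4 : 0 < τ - s := by linarith
        rw [h2, setLIntegral_one, Real.volume_Ioc, sub_zero,
          ← ENNReal.ofReal_add hT0.le (by positivity)]
        congr 1
        field_simp
        ring

/-- Each defining inequality is closed in `C`, so it passes to the infimum. The infimum is positive
because some `[-n, n]` has mass above `1/2`, which forces `C ≥ 1/(2 n^τ)`. -/
lemma isRegConst_tauConst {μ : Measure ℝ} [IsProbabilityMeasure μ] {τ : ℝ}
    (hreg : TauRegular μ τ) : IsRegConst μ τ (tauConst μ τ) := by
  have hne : {C | IsRegConst μ τ C}.Nonempty := hreg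
  constructor
  · have h1 : Filter.Tendsto (fun n : ℕ => μ (Set.Icc (0 - (n : ℝ)) (0 + n))) Filter.atTop
        (nhds (μ Set.univ)) := by
      have h2 : (⋃ n : ℕ, Set.Icc (0 - (n : ℝ)) (0 + n)) = Set.univ := by
        rw [Set.eq_univ_iff_forall]
        intro x
        obtain ⟨n, hn⟩ := exists_nat_ge |x|
        rw [Set.mem_iUnion]
        exact ⟨n, by simpa using abs_le.1 hn⟩
      rw [← h2]
      refine tendsto_measure_iUnion_atTop fun m n hmn => Set.Icc_subset_Icc ?_ ?_ <;>
      · have : (m : ℝ) ≤ n := Nat.cast_le.2 hmn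
        linarith
    rw [measure_univ] at h1
    obtain ⟨n, hn, hn0⟩ := ((h1.eventually (lt_mem_nhds (show (1 / 2 : ℝ≥0∞) < 1 from
      ENNReal.half_lt_self one_ne_zero ENNReal.one_ne_top))).and
        (Filter.eventually_gt_atTop 0)).exists
    have hn0' : (0 : ℝ) < n := Nat.cast_pos.2 hn0
    refine lt_of_lt_of_le (b := 1 / 2 / (n : ℝ) ^ τ) (by positivity) (le_csInf hne fun C hC => ?_)
    have h3 := hn.le.trans (hC.2 0 n hn0')
    rw [div_le_iff₀ (by positivity)]
    have h4 : (1 / 2 : ℝ≥0∞) = ENNReal.ofReal (1 / 2) := by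
      rw [ENNReal.ofReal_div_of_pos two_pos]; simp
    rw [h4] at h3
    exact (ENNReal.ofReal_le_ofReal_iff (mul_nonneg hC.1.le (by positivity))).1 h3
  · intro v δ hδ
    have hM : 0 ≤ tauConst μ τ := Real.sInf_nonneg fun C hC => hC.1.le
    rw [ENNReal.le_ofReal_iff_toReal_le (measure_ne_top _ _) (by positivity), ← div_le_iff₀ (by positivity)]
    refine le_csInf hne fun C hC => ?_
    rw [div_le_iff₀ (by positivity)]
    exact (ENNReal.le_ofReal_iff_toReal_le (measure_ne_top _ _)
      (mul_nonneg hC.1.le (by positivity))).1 (hC.2 v δ hδ)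

/-- The fractional moment bound for a single diagonal resolvent entry as a function of the
potential at that site. -/
lemma lintegral_enorm_rpow_le_of_mul_eq {μ : Measure ℝ} [IsProbabilityMeasure μ] {τ C s lam : ℝ}
    (hC : IsRegConst μ τ C) (hs0 : 0 < s) (hs1 : s < τ) (hlam : 0 < lam) {ψ : ℝ → ℂ} (r : ℂ)
    (hm : AEMeasurable ψ μ) (hψ : ∀ᵐ t ∂μ, ψ t * (1 + (lam * t : ℝ) * r) = r) :
    ∫⁻ t, ‖ψ t‖ₑ ^ s ∂μ ≤ ENNReal.ofReal (τ / (τ - s) * C ^ (s / τ) / lam ^ s) := by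
  -- For `r ≠ 0` the relation says `1/ψ(t) = r⁻¹ + λ t`, whose modulus is at least that of its real
  -- part. This places the singularity at the real point `-Re(r⁻¹)/λ`.
  have key := lintegral_le_of_isRegConst hC hs0 hs1 (b := -(r⁻¹.re) / lam)
    (f := fun t => lam ^ s * ‖ψ t‖ ^ s) (fun t => by positivity)
    ((hm.norm.pow_const s).const_mul _) ?_
  · have h1 : ∀ t, ENNReal.ofReal (lam ^ s * ‖ψ t‖ ^ s) = ENNReal.ofReal (lam ^ s) * ‖ψ t‖ₑ ^ s := by
      intro t
      rw [ENNReal.ofReal_mul (by positivity), ← ofReal_norm,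
        ENNReal.ofReal_rpow_of_nonneg (norm_nonneg _) hs0.le]
    simp only [h1] at key
    rw [lintegral_const_mul' _ _ ENNReal.ofReal_ne_top, mul_comm] at key
    rw [ENNReal.ofReal_div_of_pos (by positivity)]
    rwa [ENNReal.le_div_iff_mul_le (Or.inl (by simp; positivity)) (Or.inl ENNReal.ofReal_ne_top)]
  · filter_upwards [hψ] with t ht
    rw [← Real.mul_rpow hlam.le (norm_nonneg _), ← Real.mul_rpow (by positivity) (abs_nonneg _)]
    refine Real.rpow_le_one (by positivity) ?_ hs0.le
    by_cases hr : r = 0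
    · rw [hr, mul_zero, add_zero, mul_one] at ht
      rw [ht]; simp
    · have h1 : ψ t * (r⁻¹ + (lam * t : ℝ)) = 1 := by
        field_simp
        linear_combination ht
      have h2 : |r⁻¹.re + lam * t| ≤ ‖r⁻¹ + (lam * t : ℝ)‖ := by
        have := Complex.abs_re_le_norm (r⁻¹ + (lam * t : ℝ))
        rwa [Complex.add_re, Complex.ofReal_re] at this
      have h3 : lam * |t - -(r⁻¹.re) / lam| = |r⁻¹.re + lam * t| := by
        nth_rw 1 [← abs_of_pos hlam]
        rw [← abs_mul]
        congr 1
        field_simp; ring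
      calc lam * ‖ψ t‖ * |t - -(r⁻¹.re) / lam| = ‖ψ t‖ * (lam * |t - -(r⁻¹.re) / lam|) := by ring
        _ ≤ ‖ψ t‖ * ‖r⁻¹ + (lam * t : ℝ)‖ := by rw [h3]; gcongr
        _ = 1 := by rw [← norm_mul, h1, norm_one]

/-! ### Integrating out one site of the disorder -/

instance (d : ℕ) (P₀ : Measure ℝ) [IsProbabilityMeasure P₀] : IsProbabilityMeasure (disorder d P₀) :=
  inferInstanceAs (IsProbabilityMeasure (Measure.infinitePi _))

lemma measurable_update_uncurry {d : ℕ} (u : Lat d) :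
    Measurable fun p : (Lat d → ℝ) × ℝ => Function.update p.1 u p.2 := by
  refine measurable_pi_iff.2 fun y => ?_
  rcases eq_or_ne y u with rfl | h
  · simpa using measurable_snd
  · simp only [Function.update_of_ne h]
    exact (measurable_pi_apply y).comp measurable_fst

/-- Resampling one coordinate independently preserves a product law, as seen on cylinder sets. This
replaces conditioning on the other sites. -/
lemma map_update_disorder (d : ℕ) (P₀ : Measure ℝ) [IsProbabilityMeasure P₀] (u : Lat d) :
    ((disorder d P₀).prod P₀).map (fun p => Function.update p.1 u p.2) = disorder d P₀ := by
  refine Measure.eq_infinitePi _ fun S t ht => ?_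
  rw [Measure.map_apply (measurable_update_uncurry u) (.pi S.countable_toSet fun i _ => ht i)]
  have h : (fun p : (Lat d → ℝ) × ℝ => Function.update p.1 u p.2) ⁻¹' Set.pi S t =
      Set.pi (S.erase u) t ×ˢ (if u ∈ S then t u else Set.univ) := by
    ext ⟨ω, r⟩
    simp only [Set.mem_preimage, Set.mem_pi, Set.mem_prod, Finset.mem_coe, Finset.mem_erase]
    constructor
    · intro h
      refine ⟨fun i hi => by simpa [hi.1] using h i hi.2, ?_⟩
      split_ifs with hu
      · simpa using h u hu
      · trivial
    · rintro ⟨h1, h2⟩ i hi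
      rcases eq_or_ne i u with rfl | hiu
      · rw [if_pos hi] at h2; simpa using h2
      · simpa [hiu] using h1 i ⟨hiu, hi⟩
  rw [h, Measure.prod_prod, disorder, Measure.infinitePi_pi _ fun i _ => ht i]
  split_ifs with hu
  · rw [mul_comm, Finset.mul_prod_erase S (fun i => P₀ (t i)) hu]
  · rw [measure_univ, mul_one, Finset.erase_eq_of_notMem hu]

lemma lintegral_disorder_update {d : ℕ} (P₀ : Measure ℝ) [IsProbabilityMeasure P₀] (u : Lat d)
    {f : (Lat d → ℝ) → ℝ≥0∞} (hf : Measurable f) :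
    ∫⁻ ω, f ω ∂(disorder d P₀) =
      ∫⁻ ω, ∫⁻ t, f (Function.update ω u t) ∂P₀ ∂(disorder d P₀) := by
  conv_lhs => rw [← map_update_disorder d P₀ u]
  rw [lintegral_map hf (measurable_update_uncurry u),
    lintegral_prod (fun p : (Lat d → ℝ) × ℝ => f (Function.update p.1 u p.2))
      (hf.comp (measurable_update_uncurry u)).aemeasurable]

/-! ### The fractional moments of depleted resolvents -/

/-- Truncation of a real number to `[-B, B]`. -/
def clamp (B t : ℝ) : ℝ := max (-B) (min B t)

lemma clamp_of_abs_le {B t : ℝ} (h : |t| ≤ B) : clamp B t = t := by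
  rw [clamp, min_eq_right (abs_le.1 h).2, max_eq_right (abs_le.1 h).1]

lemma abs_clamp_le {B : ℝ} (hB : 0 ≤ B) (t : ℝ) : |clamp B t| ≤ B :=
  abs_le.2 ⟨le_max_left _ _, max_le (by linarith) (min_le_left _ _)⟩

lemma continuous_clamp (B : ℝ) : Continuous (clamp B) := by
  unfold clamp; fun_prop

/-- The truncated random potential. -/
def clampPot {d : ℕ} (lam B : ℝ) (ω : Lat d → ℝ) (x : Lat d) : ℝ := lam * clamp B (ω x)

section

variable {d : ℕ} {A : Ell2 d →L[ℂ] Ell2 d} (hA : IsSelfAdjoint A) {lam B : ℝ} (hlam : 0 < lam)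
  (hB : 0 ≤ B) {z : ℂ} (hz : z.im ≠ 0)

lemma clampPot_update (ω : Lat d → ℝ) (u : Lat d) (t : ℝ) :
    clampPot lam B (Function.update ω u t) =
      Function.update (clampPot lam B ω) u (lam * clamp B t) := by
  ext y
  rcases eq_or_ne y u with rfl | h
  · simp [clampPot]
  · simp [clampPot, h]

include hlam hB in
lemma abs_clampPot_le (ω : Lat d → ℝ) (x : Lat d) : |clampPot lam B ω x| ≤ lam * B := by
  rw [clampPot, abs_mul, abs_of_pos hlam]
  exact mul_le_mul_of_nonneg_left (abs_clamp_le hB _) hlam.le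

include hlam hB in
lemma exists_bound_clampPot (ω : Lat d → ℝ) : ∃ C, ∀ x, |clampPot lam B ω x| ≤ C :=
  ⟨_, abs_clampPot_le hlam hB ω⟩

/-- The Green's function with the sites of `F` removed. -/
noncomputable def depletedGreen (A : Ell2 d →L[ℂ] Ell2 d) (lam B : ℝ) (z : ℂ) (F : Set (Lat d))
    (x y : Lat d) (ω : Lat d → ℝ) : ℂ :=
  matEl (depletedRes A (clampPot lam B ω) F z) x y

include hA hlam hB hz in
lemma measurable_depletedGreen (F : Set (Lat d)) (x y : Lat d) :
    Measurable (depletedGreen A lam B z F x y) := by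
  refine Continuous.measurable (continuous_matEl_depletedRes hA (abs_clampPot_le hlam hB)
    (fun x => ?_) F hz x y)
  exact continuous_const.mul ((continuous_clamp B).comp (continuous_apply x))

variable (P₀ : Measure ℝ) [IsProbabilityMeasure P₀] (hP : ∀ᵐ t ∂P₀, |t| ≤ B) {τ s C : ℝ}
  (hC : IsRegConst P₀ τ C) (hs0 : 0 < s) (hs1 : s < τ)

include hA hlam hB hz hP hC hs0 hs1 in
lemma lintegral_depletedGreen_self_update_le {F : Set (Lat d)} {u : Lat d} (hu : u ∉ F)
    (ω : Lat d → ℝ) :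
    ∫⁻ t, ‖depletedGreen A lam B z F u u (Function.update ω u t)‖ₑ ^ s ∂P₀ ≤
      ENNReal.ofReal (τ / (τ - s) * C ^ (s / τ) / lam ^ s) := by
  have hv := exists_bound_clampPot hlam hB ω
  refine lintegral_enorm_rpow_le_of_mul_eq hC hs0 hs1 hlam
    (matEl (depletedRes A (Function.update (clampPot lam B ω) u 0) F z) u u) ?_ ?_
  · exact ((measurable_depletedGreen hA hlam hB hz F u u).comp
      (measurable_update ω)).aemeasurable
  · filter_upwards [hP] with t ht
    have h := matEl_depletedRes_update_mul hA hv hz hu (lam * clamp B t)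
    rw [← clampPot_update, clamp_of_abs_le ht] at h
    exact h

include hA hlam hB hz hP hC hs0 hs1 in
-- The factor `Φ` leaves the inner integral over `ω_u`, where the diagonal bound is uniform in the
-- remaining coordinates.
lemma lintegral_depletedGreen_self_mul_le {F : Set (Lat d)} {u : Lat d} (hu : u ∉ F)
    {Φ : (Lat d → ℝ) → ℝ≥0∞} (hΦ : Measurable Φ) (hΦu : ∀ ω t, Φ (Function.update ω u t) = Φ ω) :
    ∫⁻ ω, ‖depletedGreen A lam B z F u u ω‖ₑ ^ s * Φ ω ∂(disorder d P₀) ≤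
      ENNReal.ofReal (τ / (τ - s) * C ^ (s / τ) / lam ^ s) * ∫⁻ ω, Φ ω ∂(disorder d P₀) := by
  have hm := measurable_depletedGreen hA hlam hB hz F u u
  rw [lintegral_disorder_update P₀ u (f := fun ω => ‖depletedGreen A lam B z F u u ω‖ₑ ^ s * Φ ω)
    ((hm.enorm.pow_const s).mul hΦ), ← lintegral_const_mul _ hΦ]
  refine lintegral_mono fun ω => ?_
  simp only [hΦu]
  rw [lintegral_mul_const (f := fun t => ‖depletedGreen A lam B z F u u (Function.update ω u t)‖ₑ ^ s)
    _ (((hm.comp (measurable_update ω)).enorm).pow_const s)]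
  gcongr
  exact lintegral_depletedGreen_self_update_le hA hlam hB hz P₀ hP hC hs0 hs1 hu ω

include hA hlam hB hz hs0 in
lemma enorm_depletedGreen_rpow_le (hs : s ≤ 1) {F : Set (Lat d)} {u x : Lat d} (hu : u ∉ F)
    (hx : x ∉ F) (hxu : x ≠ u) (ω : Lat d → ℝ) :
    ‖depletedGreen A lam B z F u x ω‖ₑ ^ s ≤ ‖depletedGreen A lam B z F u u ω‖ₑ ^ s *
      ∑' y, ‖matEl A u y‖ₑ ^ s * ‖depletedGreen A lam B z (insert u F) y x ω‖ₑ ^ s := by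
  have hv := exists_bound_clampPot hlam hB ω
  have h := Ell2.hasSum_matEl A
    (depletedRes A (clampPot lam B ω) (insert u F) z (Ell2.delta x)) u
  rw [depletedGreen, matEl_depletedRes_eq hA hv hz hu hx hxu, enorm_neg, enorm_mul,
    ENNReal.mul_rpow_of_nonneg _ _ hs0.le, ← h.tsum_eq]
  refine mul_le_mul_right (le_trans (ENNReal.rpow_le_rpow enorm_tsum_le_tsum_enorm hs0.le) ?_) _
  refine (ENNReal_rpow_tsum_le _ hs0 hs).trans_eq (tsum_congr fun y => ?_)
  rw [enorm_mul, ENNReal.mul_rpow_of_nonneg _ _ hs0.le]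
  rfl

/-- The fractional moment of a depleted Green's function. -/
noncomputable def greenMoment (A : Ell2 d →L[ℂ] Ell2 d) (lam B : ℝ) (z : ℂ) (P₀ : Measure ℝ)
    [IsProbabilityMeasure P₀] (s : ℝ) (F : Set (Lat d)) (x y : Lat d) : ℝ≥0∞ :=
  ∫⁻ ω, ‖depletedGreen A lam B z F x y ω‖ₑ ^ s ∂(disorder d P₀)

include hA hlam hB hz hP hC hs0 hs1 in
lemma greenMoment_self_le {F : Set (Lat d)} {u : Lat d} (hu : u ∉ F) :
    greenMoment A lam B z P₀ s F u u ≤ ENNReal.ofReal (τ / (τ - s) * C ^ (s / τ) / lam ^ s) := by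
  simpa [greenMoment] using lintegral_depletedGreen_self_mul_le hA hlam hB hz P₀ hP hC hs0 hs1 hu
    (Φ := fun _ => 1) measurable_const fun _ _ => rfl

include hA hlam hB hz hP hC hs0 hs1 in
lemma greenMoment_le_tsum (hs : s ≤ 1) {F : Set (Lat d)} {u x : Lat d} (hu : u ∉ F)
    (hx : x ∉ F) (hxu : x ≠ u) :
    greenMoment A lam B z P₀ s F u x ≤ ENNReal.ofReal (τ / (τ - s) * C ^ (s / τ) / lam ^ s) *
      ∑' y, ‖matEl A u y‖ₑ ^ s * greenMoment A lam B z P₀ s (insert u F) y x := by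
  have hm : ∀ y, Measurable fun ω => ‖matEl A u y‖ₑ ^ s *
      ‖depletedGreen A lam B z (insert u F) y x ω‖ₑ ^ s := fun y =>
    ((measurable_depletedGreen hA hlam hB hz _ y x).enorm.pow_const s).const_mul _
  refine (lintegral_mono (enorm_depletedGreen_rpow_le hA hlam hB hz hs0 hs hu hx hxu)).trans
    ((lintegral_depletedGreen_self_mul_le hA hlam hB hz P₀ hP hC hs0 hs1 hu
      (.tsum hm) fun ω t => ?_).trans_eq ?_)
  · simp only [depletedGreen, clampPot_update,
      depletedRes_update_of_mem (exists_bound_clampPot hlam hB ω) (Set.mem_insert u F)]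
  · rw [lintegral_tsum fun y => (hm y).aemeasurable]
    congr 1
    refine tsum_congr fun y => ?_
    rw [lintegral_const_mul _ ((measurable_depletedGreen hA hlam hB hz _ y x).enorm.pow_const s)]
    rfl

include hA hlam hB hz in
-- Removed sites drop out of the sum over `y`. This makes the walks self-avoiding and eliminates the
-- diagonal entry `A(u,u)`.
lemma greenMoment_of_mem (hs0 : 0 < s) {F : Set (Lat d)} {u x : Lat d} (hu : u ∈ F) (hx : x ∉ F) :
    greenMoment A lam B z P₀ s F u x = 0 := by
  have h : ∀ ω, depletedGreen A lam B z F u x ω = 0 := fun ω =>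
    matEl_depletedRes_of_mem hA (exists_bound_clampPot hlam hB ω) hz hx hu
  simp [greenMoment, h, hs0]

include hA hlam hB hz in
lemma greenMoment_le (hs0 : 0 < s) (F : Set (Lat d)) (u x : Lat d) :
    greenMoment A lam B z P₀ s F u x ≤ ENNReal.ofReal |z.im|⁻¹ ^ s := by
  have h : ∀ ω, ‖depletedGreen A lam B z F u x ω‖ₑ ^ s ≤ ENNReal.ofReal |z.im|⁻¹ ^ s := by
    intro ω
    refine ENNReal.rpow_le_rpow ?_ hs0.le
    rw [← ofReal_norm]
    exact ENNReal.ofReal_le_ofReal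
      (norm_matEl_depletedRes_le hA (exists_bound_clampPot hlam hB ω) F hz u x)
  refine (lintegral_mono h).trans ?_
  simp

end

end FracAnderson

namespace FracAnderson

/-! ### Self-avoiding walk expansion -/

variable {d : ℕ}

/-- Self-avoiding walks from `u` to `x` with `n` steps that avoid the set `F`. -/
abbrev AvoidingSAW (n : ℕ) (F : Set (Lat d)) (u x : Lat d) : Type :=
  {w : Fin (n + 1) → Lat d //
    w 0 = u ∧ w (Fin.last n) = x ∧ Function.Injective w ∧ ∀ i, w i ∉ F}

/-- The total weight of the self-avoiding walks from `u` to `x` with `n` steps avoiding `F`. -/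
noncomputable def avoidingSum (D : Lat d → Lat d → ℝ≥0) (n : ℕ) (F : Set (Lat d)) (u x : Lat d) :
    ℝ≥0∞ :=
  ∑' w : AvoidingSAW n F u x, ∏ j : Fin n, (D (w.1 j.castSucc) (w.1 j.succ) : ℝ≥0∞)

lemma one_le_avoidingSum_zero (D : Lat d → Lat d → ℝ≥0) {F : Set (Lat d)} {u : Lat d}
    (hu : u ∉ F) : 1 ≤ avoidingSum D 0 F u u := by
  let w : AvoidingSAW 0 F u u := ⟨fun _ => u, rfl, rfl,
    fun i j _ => Subsingleton.elim (α := Fin 1) i j, fun _ => hu⟩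
  refine le_trans ?_ (ENNReal.le_tsum w)
  simp

/-- Prepending `u` to a walk that avoids `insert u F` gives a self-avoiding walk that avoids `F`;
only the injectivity of this map is used. -/
lemma tsum_mul_avoidingSum_le (D : Lat d → Lat d → ℝ≥0) (n : ℕ) {F : Set (Lat d)} {u : Lat d}
    (hu : u ∉ F) (x : Lat d) :
    ∑' y, (D u y : ℝ≥0∞) * avoidingSum D n (insert u F) y x ≤ avoidingSum D (n + 1) F u x := by
  simp only [avoidingSum, ← ENNReal.tsum_mul_left]
  rw [← ENNReal.tsum_sigma' fun p : (Σ y, AvoidingSAW n (insert u F) y x) =>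
    (D u p.1 : ℝ≥0∞) * ∏ j : Fin n, (D (p.2.1 j.castSucc) (p.2.1 j.succ) : ℝ≥0∞)]
  let φ : (Σ y, AvoidingSAW n (insert u F) y x) → AvoidingSAW (n + 1) F u x := fun p =>
    ⟨Fin.cons u p.2.1, rfl, by
      rw [← Fin.succ_last, Fin.cons_succ]; exact p.2.2.2.1, by
      rw [Fin.cons_injective_iff]
      refine ⟨?_, p.2.2.2.2.1⟩
      rintro ⟨i, hi⟩
      exact p.2.2.2.2.2 i (Set.mem_insert_iff.2 (Or.inl hi)), by
      intro i
      refine Fin.cases ?_ (fun j => ?_) i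
      · exact hu
      · rw [Fin.cons_succ]
        exact fun h => p.2.2.2.2.2 j (Set.mem_insert_of_mem u h)⟩
  have hφ : Function.Injective φ := by
    rintro ⟨y, w, hw⟩ ⟨y', w', hw'⟩ h
    have h1 : w = w' := Fin.cons_right_injective (α := fun _ => Lat d) u (congrArg Subtype.val h)
    subst h1
    have h2 : y = y' := hw.1.symm.trans hw'.1
    subst h2
    rfl
  refine le_trans (le_of_eq ?_) (ENNReal.tsum_comp_le_tsum_of_injective hφ _)
  refine tsum_congr fun p => ?_
  rw [Fin.prod_univ_succ]
  have h0 : p.2.1 0 = p.1 := p.2.2.1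
  simp only [φ, Fin.castSucc_zero, Fin.cons_zero, Fin.cons_succ, ← Fin.succ_castSucc, h0]

/-- The recursion `h_step` is iterated for all `F` and `u` at once. The first term collects walks
that have reached `x`, closed by `h_self`; the second bounds the unfinished ones by the a priori
constant `M`, summed over all endpoints. -/
lemma avoidingSum_expansion (D : Lat d → Lat d → ℝ≥0) {γ M : ℝ≥0∞}
    {g : Set (Lat d) → Lat d → Lat d → ℝ≥0∞}
    (h_self : ∀ F u, u ∉ F → g F u u ≤ γ)
    (h_step : ∀ F u x, u ∉ F → x ∉ F → x ≠ u →
      g F u x ≤ γ * ∑' y, (D u y : ℝ≥0∞) * g (insert u F) y x)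
    (h_mem : ∀ F u x, u ∈ F → x ∉ F → g F u x = 0)
    (h_le : ∀ F u x, g F u x ≤ M) (n : ℕ) (F : Set (Lat d)) (u x : Lat d) (hu : u ∉ F)
    (hx : x ∉ F) :
    g F u x ≤ γ * ∑ k ∈ Finset.range n, avoidingSum D k F u x * γ ^ k +
      M * ((∑' y, avoidingSum D n F u y) * γ ^ n) := by
  induction n generalizing F u with
  | zero =>
    simp only [Finset.range_zero, Finset.sum_empty, mul_zero, zero_add, pow_zero, mul_one]
    -- The zero-step walk at `u` has weight `1`, so the remainder already dominates `M`.
    refine (h_le F u x).trans (le_mul_of_one_le_right' ?_)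
    exact (one_le_avoidingSum_zero D hu).trans (ENNReal.le_tsum u)
  | succ n ih =>
    rcases eq_or_ne x u with rfl | hxu
    -- Here the `k = 0` term alone suffices.
    · refine (h_self F x hu).trans (le_add_right (le_mul_of_one_le_right' ?_))
      refine le_trans ?_ (Finset.single_le_sum (f := fun k => avoidingSum D k F x x * γ ^ k)
        (fun _ _ => zero_le) (Finset.mem_range.2 n.succ_pos))
      simpa using one_le_avoidingSum_zero D hu
    · have hx' : x ∉ insert u F := by simp [hxu, hx]
      have h1 : ∀ y, g (insert u F) y x ≤
          γ * ∑ k ∈ Finset.range n, avoidingSum D k (insert u F) y x * γ ^ k +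
            M * ((∑' y', avoidingSum D n (insert u F) y y') * γ ^ n) := by
        intro y
        by_cases hy : y ∈ insert u F
        · rw [h_mem _ _ _ hy hx']; exact zero_le
        · exact ih _ _ hy hx'
      have h2 : ∑' y, (D u y : ℝ≥0∞) *
          (γ * ∑ k ∈ Finset.range n, avoidingSum D k (insert u F) y x * γ ^ k) ≤
          ∑ k ∈ Finset.range n, avoidingSum D (k + 1) F u x * γ ^ (k + 1) := by
        calc _ = ∑' y, ∑ k ∈ Finset.range n,
                (D u y : ℝ≥0∞) * avoidingSum D k (insert u F) y x * γ ^ (k + 1) := by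
              refine tsum_congr fun y => ?_
              rw [Finset.mul_sum, Finset.mul_sum]
              refine Finset.sum_congr rfl fun k _ => ?_
              rw [pow_succ]; ring
          _ = ∑ k ∈ Finset.range n,
                (∑' y, (D u y : ℝ≥0∞) * avoidingSum D k (insert u F) y x) * γ ^ (k + 1) := by
              rw [Summable.tsum_finsetSum fun _ _ => ENNReal.summable]
              simp only [ENNReal.tsum_mul_right]
          _ ≤ _ := by
              gcongr with k
              exact tsum_mul_avoidingSum_le D k hu x
      have h3 : ∑' y, (D u y : ℝ≥0∞) *
          (M * ((∑' y', avoidingSum D n (insert u F) y y') * γ ^ n)) ≤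
          M * ((∑' y, avoidingSum D (n + 1) F u y) * γ ^ n) := by
        calc _ = M * ((∑' y', ∑' y, (D u y : ℝ≥0∞) * avoidingSum D n (insert u F) y y') * γ ^ n) := by
              rw [ENNReal.tsum_comm, ← ENNReal.tsum_mul_right, ← ENNReal.tsum_mul_left]
              refine tsum_congr fun y => ?_
              rw [ENNReal.tsum_mul_left]; ring
          _ ≤ _ := by
              gcongr with y'
              exact tsum_mul_avoidingSum_le D n hu y'
      calc g F u x ≤ γ * ∑' y, (D u y : ℝ≥0∞) * g (insert u F) y x := h_step F u x hu hx hxu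
        _ ≤ γ * ∑' y, (D u y : ℝ≥0∞) *
            (γ * ∑ k ∈ Finset.range n, avoidingSum D k (insert u F) y x * γ ^ k +
              M * ((∑' y', avoidingSum D n (insert u F) y y') * γ ^ n)) := by
            gcongr with y
            exact h1 y
        _ ≤ γ * (∑ k ∈ Finset.range n, avoidingSum D (k + 1) F u x * γ ^ (k + 1) +
              M * ((∑' y, avoidingSum D (n + 1) F u y) * γ ^ n)) := by
            simp only [mul_add, ENNReal.tsum_add]
            rw [← mul_add, ← mul_add]
            gcongr
        _ ≤ _ := by
            rw [mul_add, Finset.sum_range_succ']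
            refine add_le_add ?_ (le_of_eq ?_)
            · gcongr
              exact le_self_add
            · rw [pow_succ]; ring

/-- Translation by `-u` preserves the weights, and forgetting the constraint of avoiding `F` only
adds walks. -/
lemma avoidingSum_le_sawCoeff {D : Lat d → Lat d → ℝ≥0}
    (hD : ∀ x y v, D (x + v) (y + v) = D x y) (n : ℕ) (F : Set (Lat d)) (u x : Lat d) :
    avoidingSum D n F u x ≤ sawCoeff D n (x - u) := by
  let φ : AvoidingSAW n F u x → SAW n 0 (x - u) := fun w =>
    ⟨fun i => w.1 i - u, sub_eq_zero.2 w.2.1, congrArg (· - u) w.2.2.1,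
      (sub_left_injective).comp w.2.2.2.1⟩
  have hφ : Function.Injective φ := by
    intro w w' h
    refine Subtype.ext (funext fun i => ?_)
    exact sub_left_injective (congrFun (congrArg Subtype.val h) i)
  refine le_trans (le_of_eq ?_) (ENNReal.tsum_comp_le_tsum_of_injective hφ _)
  refine tsum_congr fun w => Finset.prod_congr rfl fun j _ => ?_
  rw [← hD (w.1 j.castSucc) (w.1 j.succ) (-u)]
  simp only [φ, sub_eq_add_neg]

lemma tsum_sawCoeff_mul_pow (D : Lat d → Lat d → ℝ≥0) (γ : ℝ≥0) :
    ∑' n, (∑' x, sawCoeff D n x) * (γ : ℝ≥0∞) ^ n = susceptibility D γ := by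
  simp only [susceptibility, sawTwoPoint, ← ENNReal.tsum_mul_right]
  rw [ENNReal.tsum_comm]

/-- A family of fractional moments satisfying the depletion inequalities is dominated by the
two-point function of the self-avoiding walk. -/
lemma le_mul_sawTwoPoint {D : Lat d → Lat d → ℝ≥0} (hD : ∀ x y v, D (x + v) (y + v) = D x y)
    {γ : ℝ≥0} {M : ℝ≥0∞} (hM : M ≠ ∞) (hχ : susceptibility D γ < ∞)
    {g : Set (Lat d) → Lat d → Lat d → ℝ≥0∞}
    (h_self : ∀ F u, u ∉ F → g F u u ≤ γ)
    (h_step : ∀ F u x, u ∉ F → x ∉ F → x ≠ u →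
      g F u x ≤ γ * ∑' y, (D u y : ℝ≥0∞) * g (insert u F) y x)
    (h_mem : ∀ F u x, u ∈ F → x ∉ F → g F u x = 0)
    (h_le : ∀ F u x, g F u x ≤ M) (u x : Lat d) :
    g ∅ u x ≤ γ * sawTwoPoint D γ (x - u) := by
  rw [← tsum_sawCoeff_mul_pow] at hχ
  -- The remainder is `M` times a term of the convergent susceptibility series, hence tends to zero.
  have h1 := (ENNReal.Tendsto.const_mul (a := M)
    (ENNReal.tendsto_atTop_zero_of_tsum_ne_top hχ.ne) (Or.inr hM)).const_add
      ((γ : ℝ≥0∞) * sawTwoPoint D γ (x - u))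
  rw [mul_zero, add_zero] at h1
  refine ge_of_tendsto h1 (Filter.Eventually.of_forall fun n => ?_)
  refine (avoidingSum_expansion D h_self h_step h_mem h_le n ∅ u x (Set.notMem_empty _)
    (Set.notMem_empty _)).trans (add_le_add ?_ ?_)
  · gcongr
    refine le_trans ?_ (ENNReal.sum_le_tsum (Finset.range n))
    gcongr
    exact avoidingSum_le_sawCoeff hD _ _ _ _
  · refine mul_le_mul_right (mul_le_mul_left ?_ _) _
    rw [← (Equiv.subRight u).tsum_eq (sawCoeff D n)]
    exact ENNReal.tsum_le_tsum fun y => avoidingSum_le_sawCoeff hD n ∅ u y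

/-! ### Positivity of the radius of convergence. -/

lemma tsum_walk_eq_pow {D : Lat d → Lat d → ℝ≥0} {S : ℝ≥0∞}
    (hS : ∀ u, ∑' y, (D u y : ℝ≥0∞) = S) (n : ℕ) (u : Lat d) :
    ∑' v : Fin n → Lat d,
      ∏ j : Fin n, (D ((Fin.cons u v : Fin (n + 1) → Lat d) j.castSucc) (v j) : ℝ≥0∞) = S ^ n := by
  induction n generalizing u with
  | zero => rw [tsum_eq_single default fun v hv => absurd (Subsingleton.elim _ _) hv]; simp
  | succ n ih =>
    rw [← (Fin.consEquiv fun _ => Lat d).tsum_eq, ENNReal.tsum_prod', pow_succ']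
    nth_rw 1 [← hS u]
    rw [← ENNReal.tsum_mul_right]
    refine tsum_congr fun y => ?_
    rw [← ih y, ← ENNReal.tsum_mul_left]
    refine tsum_congr fun v => ?_
    rw [Fin.prod_univ_succ]
    simp only [Fin.consEquiv_apply, Fin.castSucc_zero, Fin.cons_zero, ← Fin.succ_castSucc,
      Fin.cons_succ]

/-- Without self-avoidance the sum factorizes. A walk from `0` is determined by its later sites,
which also fix the endpoint. -/
lemma tsum_sawCoeff_le_pow {D : Lat d → Lat d → ℝ≥0} {S : ℝ≥0∞}
    (hS : ∀ u, ∑' y, (D u y : ℝ≥0∞) = S) (n : ℕ) : ∑' x, sawCoeff D n x ≤ S ^ n := by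
  change ∑' (x) (w : SAW n 0 x), ∏ j : Fin n, (D (w.1 j.castSucc) (w.1 j.succ) : ℝ≥0∞) ≤ _
  rw [← ENNReal.tsum_sigma' fun p : (Σ x, SAW n (0 : Lat d) x) =>
    ∏ j : Fin n, (D (p.2.1 j.castSucc) (p.2.1 j.succ) : ℝ≥0∞), ← tsum_walk_eq_pow hS n 0]
  let φ : (Σ x, SAW n (0 : Lat d) x) → (Fin n → Lat d) := fun p => Fin.tail p.2.1
  have hc : ∀ p : (Σ x, SAW n (0 : Lat d) x),
      (Fin.cons 0 (φ p) : Fin (n + 1) → Lat d) = p.2.1 := by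
    intro p
    have h0 : p.2.1 0 = 0 := p.2.2.1
    exact (congrArg (fun a : Lat d => (Fin.cons a (φ p) : Fin (n + 1) → Lat d)) h0.symm).trans
      (Fin.cons_self_tail _)
  have hφ : Function.Injective φ := by
    intro p p' h
    have h1 : p.2.1 = p'.2.1 := by rw [← hc p, ← hc p', h]
    obtain ⟨x, w, hw⟩ := p
    obtain ⟨x', w', hw'⟩ := p'
    change w = w' at h1
    subst h1
    have h2 : x = x' := hw.2.1.symm.trans hw'.2.1
    subst h2
    rfl
  refine le_trans (le_of_eq ?_) (ENNReal.tsum_comp_le_tsum_of_injective hφ _)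
  refine tsum_congr fun p => Finset.prod_congr rfl fun j _ => ?_
  rw [hc p]
  rfl

lemma susceptRadius_pos {D : Lat d → Lat d → ℝ≥0} {S : ℝ≥0∞}
    (hS : ∀ u, ∑' y, (D u y : ℝ≥0∞) = S) (hS_top : S ≠ ∞) : 0 < susceptRadius D := by
  lift S to ℝ≥0 using hS_top
  -- The choice `γ = 1/(S+1)` keeps `S γ < 1` even when `S = 0`.
  have h1 : susceptibility D (S + 1)⁻¹ < ∞ := by
    have hr : S * (S + 1)⁻¹ < 1 := by
      rw [← div_eq_mul_inv, div_lt_one (by positivity)]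
      exact lt_add_one S
    rw [← tsum_sawCoeff_mul_pow]
    refine lt_of_le_of_lt (b := ∑' n : ℕ, (((S * (S + 1)⁻¹) ^ n : ℝ≥0) : ℝ≥0∞)) ?_ ?_
    · refine ENNReal.tsum_le_tsum fun n => ?_
      rw [mul_pow, ENNReal.coe_mul, ENNReal.coe_pow, ENNReal.coe_pow]
      gcongr
      exact tsum_sawCoeff_le_pow hS n
    · exact (ENNReal.tsum_coe_ne_top_iff_summable.2 (NNReal.summable_geometric hr)).lt_top
  refine lt_of_lt_of_le (b := (((S + 1)⁻¹ : ℝ≥0) : ℝ≥0∞)) ?_ (le_iSup₂_of_le _ h1 le_rfl)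
  exact ENNReal.coe_pos.2 (by positivity)

lemma susceptibility_lt_top_of_lt {D : Lat d → Lat d → ℝ≥0} {γ : ℝ≥0}
    (h : (γ : ℝ≥0∞) < susceptRadius D) : susceptibility D γ < ∞ := by
  rw [susceptRadius] at h
  simp only [lt_iSup_iff] at h
  obtain ⟨γ', hγ', hlt⟩ := h
  refine lt_of_le_of_lt ?_ hγ'
  rw [← tsum_sawCoeff_mul_pow, ← tsum_sawCoeff_mul_pow]
  gcongr

/-! ### The disorder threshold and the passage to the original model. -/

lemma gammaParam_lt_susceptRadius {α τ s lam : ℝ} {P₀ : Measure ℝ} (hs : 0 < s) (hlam : 0 < lam)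
    (hR : 0 < susceptRadius (kernelD d α s)) (h : lambda0 d α P₀ τ s < ENNReal.ofReal lam) :
    (gammaParam P₀ τ s lam : ℝ≥0∞) < susceptRadius (kernelD d α s) := by
  have h1 := ENNReal.rpow_lt_rpow h hs
  rw [lambda0, ← ENNReal.rpow_mul, one_div_mul_cancel hs.ne', ENNReal.rpow_one,
    ENNReal.ofReal_rpow_of_pos hlam] at h1
  have hl : (0 : ℝ) < lam ^ s := by positivity
  change ENNReal.ofReal (theta P₀ τ s / lam ^ s) < _
  rw [ENNReal.ofReal_div_of_pos hl]
  rw [ENNReal.div_lt_iff (Or.inl (by simpa using hl)) (Or.inl ENNReal.ofReal_ne_top), mul_comm]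
  rwa [ENNReal.div_lt_iff (Or.inl hR.ne') (Or.inr ENNReal.ofReal_ne_top)] at h1

/-- Truncation gives every `ω` a potential with the same bound, so the resolvent identities hold
everywhere. On the almost sure event that all `|ω_x| ≤ B` nothing is changed. -/
lemma green_eq_depletedGreen {α lam B : ℝ} (hB : 0 ≤ B) (hlam : 0 < lam) {ω : Lat d → ℝ}
    (hω : ∀ x, |ω x| ≤ B) (z : ℂ) (x y : Lat d) :
    green d α lam ω z x y = depletedGreen (fracLaplacian d α) lam B z ∅ x y ω := by
  have h : (lam : ℂ) • mulOp ω = mulOp (clampPot lam B ω) := by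
    ext f x
    rw [smul_apply, Ell2.smul_apply, mulOp_apply ⟨B, hω⟩,
      mulOp_apply (exists_bound_clampPot hlam hB ω), clampPot, clamp_of_abs_le (hω x),
      Complex.ofReal_mul, mul_assoc]
  rw [green, depletedGreen, depletedRes, depletedOp_empty, hamiltonian, h]

end FracAnderson

open FracAnderson
theorem theorem1 (d : ℕ) (hd : 1 ≤ d) (α : ℝ) (hα0 : 0 < α) (hα1 : α < 1)
    (P₀ : Measure ℝ) [IsProbabilityMeasure P₀] (hsupp : ∃ K : Set ℝ, IsCompact K ∧ P₀ Kᶜ = 0)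
    (τ : ℝ) (hτ0 : (d : ℝ) / (d + 2 * α) < τ) (hτ1 : τ < 1) (hreg : TauRegular P₀ τ)
    (s : ℝ) (hs0 : (d : ℝ) / (d + 2 * α) < s) (hs1 : s < τ) :
    0 < susceptRadius (kernelD d α s) ∧
    ∀ lam : ℝ, 0 < lam → lambda0 d α P₀ τ s < ENNReal.ofReal lam →
      (∀ x : Lat d, sawTwoPoint (kernelD d α s) (gammaParam P₀ τ s lam) x < ∞) ∧
      ∀ z : ℂ, z.im ≠ 0 → ∀ x₀ x : Lat d, x ≠ x₀ →
        AEMeasurable (fun ω => green d α lam ω z x₀ x) (disorder d P₀) ∧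
        ∫⁻ ω, ENNReal.ofReal (‖green d α lam ω z x₀ x‖ ^ s) ∂(disorder d P₀) ≤
          (gammaParam P₀ τ s lam : ℝ≥0∞) *
            sawTwoPoint (kernelD d α s) (gammaParam P₀ τ s lam) (x - x₀) := by
  have hs : 0 < s := (by positivity : (0 : ℝ) ≤ d / (d + 2 * α)).trans_lt hs0
  have hR : 0 < susceptRadius (kernelD d α s) :=
    susceptRadius_pos (tsum_kernelD_eq hd hα0 hα1 s)
      (tsum_kernelD_zero_lt_top hd hα0 hα1 hs0 (hs1.trans hτ1)).ne
  refine ⟨hR, fun lam hlam hlt => ?_⟩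
  have hχ := susceptibility_lt_top_of_lt (gammaParam_lt_susceptRadius hs hlam hR hlt)
  refine ⟨fun x => (ENNReal.le_tsum x).trans_lt hχ, fun z hz x₀ x _ => ?_⟩
  obtain ⟨K, hK, hPK⟩ := hsupp
  obtain ⟨B₀, hB₀⟩ := hK.isBounded.exists_norm_le
  set B := max B₀ 0 with hB_def
  have hB : 0 ≤ B := le_max_right _ _
  have hP : ∀ᵐ t ∂P₀, |t| ≤ B := by
    filter_upwards [compl_mem_ae_iff.2 hPK] with t ht
    exact (hB₀ t (by simpa using ht)).trans (le_max_left _ _)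
  -- The lattice is countable, so the almost sure bounds hold at all sites simultaneously.
  have hω : ∀ᵐ ω ∂(disorder d P₀), ∀ y, |ω y| ≤ B := by
    rw [ae_all_iff]
    exact fun y => (measurePreserving_eval_infinitePi (fun _ : Lat d => P₀) y).quasiMeasurePreserving.ae hP
  have hA := isSelfAdjoint_fracLaplacian d α
  have hC := isRegConst_tauConst hreg
  have hae : (fun ω => green d α lam ω z x₀ x) =ᵐ[disorder d P₀]
      depletedGreen (fracLaplacian d α) lam B z ∅ x₀ x := by
    filter_upwards [hω] with ω hω
    exact green_eq_depletedGreen hB hlam hω z x₀ x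
  refine ⟨(measurable_depletedGreen hA hlam hB hz ∅ x₀ x).aemeasurable.congr hae.symm, ?_⟩
  have hD : ∀ u y, (kernelD d α s u y : ℝ≥0∞) = ‖matEl (fracLaplacian d α) u y‖ₑ ^ s := by
    intro u y
    rw [kernelD, ENNReal.coe_rpow_of_nonneg _ hs.le, enorm_eq_nnnorm]
  have hg : ∫⁻ ω, ENNReal.ofReal (‖green d α lam ω z x₀ x‖ ^ s) ∂(disorder d P₀) =
      greenMoment (fracLaplacian d α) lam B z P₀ s ∅ x₀ x := by
    refine lintegral_congr_ae ?_
    filter_upwards [hae] with ω h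
    rw [h, ← ofReal_norm, ENNReal.ofReal_rpow_of_nonneg (norm_nonneg _) hs.le]
  rw [hg]
  refine le_mul_sawTwoPoint (kernelD_translate hd hα0 hα1 s)
    (M := ENNReal.ofReal |z.im|⁻¹ ^ s) (ENNReal.rpow_ne_top_of_nonneg hs.le ENNReal.ofReal_ne_top) hχ
    (fun F u hu => greenMoment_self_le hA hlam hB hz P₀ hP hC hs hs1 hu) ?_
    (fun F u y hu hy => greenMoment_of_mem hA hlam hB hz P₀ hs hu hy)
    (fun F u y => greenMoment_le hA hlam hB hz P₀ hs F u y) x₀ x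
  intro F u y hu hy hyu
  simp only [hD]
  exact greenMoment_le_tsum hA hlam hB hz P₀ hP hC hs hs1 (hs1.trans hτ1).le hu hy hyu
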